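/- Let $n\ge 1$ be an integer, $p\in(1,\infty)$, $\gamma\in(0,1)$, $\beta\in(0,\frac1{n+p})$, and let $b$ be a real-valued locally integrable function on $\mathbb{R}^{n+1}=\mathbb{R}^n\times\mathbb{R}$. All Lebesgue spaces are over $\mathbb{R}^{n+1}$ with Lebesgue measure, functions being identified when they agree almost everywhere. For $(x,t)\in\mathbb{R}^{n+1}$ and $L>0$ let $Q(x,L)$ be the open cube with center $x$, edge length $2L$ and edges parallel to the axes, and let $R=R(x,t,L):=Q(x,L)\times(t-L^p,t+L^p)$ (a parabolic rectangle), $R^+(\gamma):=Q(x,L)\times(t+\gamma L^p,t+L^p)$ and $R^-(\gamma):=Q(x,L)\times(t-L^p,t-\gamma L^p)$. Write $f_R:=\frac1{|R|}\int_R f$. For $\sigma\in\mathbb{R}$, $\mathrm{PC}^\sigma$ is the space of all $f\in L^1_{\mathrm{loc}}$ with $$\sup_R \frac1{|R|^{\sigma}}\,\frac1{|R|}\int_R|f-f_R|<\infty ,$$ the supremum being over all parabolic rectangles $R$, and $\mathrm{PBMO}:=\mathrm{PC}^0$. Define $$M^{\gamma+}f(z):=\sup_{R:\ z\in R^-(\gamma)}\frac1{|R^+(\gamma)|}\int_{R^+(\gamma)}|f|,\qquad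 M^{\gamma-}f(z):=\sup_{R:\ z\in R^+(\gamma)}\frac1{|R^-(\gamma)|}\int_{R^-(\gamma)}|f|,$$ and, for $M\in\{M^{\gamma+},M^{\gamma-}\}$, $[b,M]f:=b\,Mf-M(bf)$. The commutator $[b,M]$ is called bounded from $L^r$ to $L^q$ (on $L^q$, if $r=q$) if there is a constant $C$ such that, for every $f\in L^r$ with $bf\in L^1_{\mathrm{loc}}$, $Mf$ and $M(bf)$ are finite almost everywhere and $\|[b,M]f\|_{L^q}\le C\|f\|_{L^r}$. Let $b_-:=\max\{-b,0\}$. (i) The following are equivalent: (a) $b\in\mathrm{PBMO}$ and $b_-\in L^\infty$; (b) for every $q\in(1,\infty)$, both $[b,M^{\gamma+}]$ and $[b,M^{\gamma-}]$ are bounded on $L^q$; (c) for some $q\in(1,\infty)$, both $[b,M^{\gamma+}]$ and $[b,M^{\gamma-}]$ are bounded on $L^q$. (ii) The following are equivalent: (a) $b\in\mathrm{PC}^\beta$ and $b\ge0$ almost everywhere; (b) for all $1<r<q<\infty$ with $\frac1r-\frac1q=\beta$, both $[b,M^{\gamma+}]$ and $[b,M^{\gamma-}]$ are bounded from $L^r$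 to $L^q$; (c) for some $1<r<q<\infty$ with $\frac1r-\frac1q=\beta$, both $[b,M^{\gamma+}]$ and $[b,M^{\gamma-}]$ are bounded from $L^r$ to $L^q$. Moreover, if $b\in\mathrm{PBMO}$ or $b\in\mathrm{PC}^\beta$, then $bf\in L^1_{\mathrm{loc}}$ for every $r\in(1,\infty)$ and every $f\in L^r$, so that the commutators in (i) and (ii) are then defined on the whole space $L^r$. -/

import Mathlib

open MeasureTheory
open scoped ENNReal NNReal

noncomputable section

namespace Parabolic

/-- The space-time `ℝⁿ × ℝ = ℝⁿ⁺¹`, equipped with its Lebesgue measure `volume`. -/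
abbrev SpaceTime (n : ℕ) : Type := (Fin n → ℝ) × ℝ

/-- The cube centered at `x` with edge length `2 * L` and edges parallel to the axes:
the norm of `Fin n → ℝ` is the maximum norm. -/
def cube {n : ℕ} (x : Fin n → ℝ) (L : ℝ) : Set (Fin n → ℝ) := Metric.ball x L

/-- The parabolic rectangle `R(x,t,L) = Q(x,L) × (t - L^p, t + L^p)`. -/
def rect {n : ℕ} (p : ℝ) (x : Fin n → ℝ) (t L : ℝ) : Set (SpaceTime n) :=
  cube x L ×ˢ Set.Ioo (t - L ^ p) (t + L ^ p)

/-- The `γ`-upper part `R⁺(γ)` of `R(x,t,L)`. -/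
def upperPart {n : ℕ} (p γ : ℝ) (x : Fin n → ℝ) (t L : ℝ) : Set (SpaceTime n) :=
  cube x L ×ˢ Set.Ioo (t + γ * L ^ p) (t + L ^ p)

/-- The `γ`-lower part `R⁻(γ)` of `R(x,t,L)`. -/
def lowerPart {n : ℕ} (p γ : ℝ) (x : Fin n → ℝ) (t L : ℝ) : Set (SpaceTime n) :=
  cube x L ×ˢ Set.Ioo (t - L ^ p) (t - γ * L ^ p)

/-- The parabolic Campanato seminorm: the supremum over all parabolic rectangles `R` of
`|R|^(-β)` times the mean over `R` of `|f - f_R|`. -/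
def campanatoSeminorm {n : ℕ} (p β : ℝ) (f : SpaceTime n → ℝ) : ℝ≥0∞ :=
  ⨆ (x : Fin n → ℝ) (t : ℝ) (L : ℝ) (_ : 0 < L),
    volume (rect p x t L) ^ (-β) *
      ⨍⁻ z in rect p x t L, ‖f z - ⨍ w in rect p x t L, f w‖ₑ ∂volume

/-- Membership in the parabolic Campanato space `PC^β`. -/
def MemPC {n : ℕ} (p β : ℝ) (f : SpaceTime n → ℝ) : Prop :=
  LocallyIntegrable f ∧ campanatoSeminorm p β f < ∞

/-- Membership in `PBMO`, the space `PC^0`. -/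
def MemPBMO {n : ℕ} (p : ℝ) (f : SpaceTime n → ℝ) : Prop := MemPC p 0 f

/-- The uncentered parabolic maximal operator `M^{γ+}` with time lag. -/
def maximalPlus {n : ℕ} (p γ : ℝ) (f : SpaceTime n → ℝ) (z : SpaceTime n) : ℝ≥0∞ :=
  ⨆ (x : Fin n → ℝ) (t : ℝ) (L : ℝ) (_ : 0 < L) (_ : z ∈ lowerPart p γ x t L),
    ⨍⁻ w in upperPart p γ x t L, ‖f w‖ₑ ∂volume

/-- The uncentered parabolic maximal operator `M^{γ-}` with time lag. -/
def maximalMinus {n : ℕ} (p γ : ℝ) (f : SpaceTime n → ℝ) (z : SpaceTime n) : ℝ≥0∞ :=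
  ⨆ (x : Fin n → ℝ) (t : ℝ) (L : ℝ) (_ : 0 < L) (_ : z ∈ upperPart p γ x t L),
    ⨍⁻ w in lowerPart p γ x t L, ‖f w‖ₑ ∂volume

/-- The commutator `[b,T] f = b * T f - T (b f)` of an operator `T` with values in `[0,∞]`,
at the points where `T f` and `T (b f)` are finite. -/
def commutator {n : ℕ} (b : SpaceTime n → ℝ)
    (T : (SpaceTime n → ℝ) → SpaceTime n → ℝ≥0∞) (f : SpaceTime n → ℝ) (z : SpaceTime n) : ℝ :=
  b z * (T f z).toReal - (T (fun w => b w * f w) z).toReal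

/-- `[b,T]` is bounded from `L^r` to `L^q`: for every `f ∈ L^r` in its natural domain
(that is, with `b f` locally integrable), `[b,T] f` is well defined almost everywhere, belongs to
`L^q`, and has `L^q` norm at most a constant times the `L^r` norm of `f`. -/
def CommutatorBounded {n : ℕ} (b : SpaceTime n → ℝ)
    (T : (SpaceTime n → ℝ) → SpaceTime n → ℝ≥0∞) (r q : ℝ) : Prop :=
  ∃ C : ℝ≥0, ∀ f : SpaceTime n → ℝ, MemLp f (ENNReal.ofReal r) →
    LocallyIntegrable (fun z => b z * f z) →
      (∀ᵐ z, T f z < ∞) ∧ (∀ᵐ z, T (fun w => b w * f w) z < ∞) ∧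
      MemLp (commutator b T f) (ENNReal.ofReal q) ∧
      eLpNorm (commutator b T f) (ENNReal.ofReal q) volume
        ≤ C * eLpNorm f (ENNReal.ofReal r) volume

end Parabolic

end

noncomputable section

open Metric Set Filter Topology

namespace Parabolic

/-! ### Dyadic layer sums -/

/-! For the parabolic metric `max |x - y| |t - s| ^ (1 / p)` the balls are exactly the parabolic
rectangles, and a ball of radius `r` has volume `2 ^ (n + 1) * r ^ (n + p)`. Vitali coverings, the
maximal theorem, Lebesgue points, the John-Nirenberg inequality and Campanato's theorem are
therefore available in the form they take in a metric space where balls have measure `c * r ^ Q`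
(`HasBallVolume`).

Sufficiency. The parts `R⁺(γ)` and `R⁻(γ)` fill a fixed fraction of `R`, so either operator `T` is
at most `κ` times the Hardy-Littlewood operator, and `|b| T f` differs from `T (b f)` by at most `κ`
times the maximal commutator `sup_{B ∋ z} ⨍_B |b z - b w| |f w| dw`. Since `b = |b| - 2 b₋`, passing
from `|b|` to `b` costs `2 b₋ T f` (`enorm_commutator_le`). This term is harmless on `L^q` if `b₋`
is bounded, and absent if `b ≥ 0`. It remains to bound the maximal commutator. For `PBMO` the
difference `b z - b w` is split at the mean over the doubled ball: the part in `w` is handled by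
Hölder and John-Nirenberg, the part in `z` by a covering of the level sets of the maximal function
(`lintegral_iSup_oscillation_mul_rpow_le`). For `PC^β` the function `b` is almost everywhere Hölder
continuous, and Hedberg's interpolation gives the gain of integrability
(`maximalCommutatorBounded_of_campanato`).

Necessity. With `f` the indicator of `R⁺(γ)`, on `R⁻(γ)` one has `M^{γ+} f = 1` and `M^{γ+} (b f) ≥
⨍_{R⁺} |b|`, so boundedness controls `∫_{R⁻} (⨍_{R⁺} |b| - b)₊` by a multiple of `|R| ^ (1 + β)`;
the other operator gives the same with the parts exchanged. Together the two bounds control the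
oscillation of `b` on `R⁻` and the integral of `b₋` on `R⁺` (`oscillation_and_negPart_le`).
Overlapping time translates of `R⁻` cover `R`, which removes the lag, and Lebesgue differentiation
turns the second bound into a pointwise one. -/

lemma two_zpow_ne_zero (k : ℤ) : (2 : ℝ≥0∞) ^ k ≠ 0 :=
  (ENNReal.zpow_pos (by simp) (by simp) k).ne'

lemma two_zpow_ne_top (k : ℤ) : (2 : ℝ≥0∞) ^ k ≠ ∞ :=
  ENNReal.zpow_ne_top (by simp) (by simp) k

lemma rpow_le_tsum_dyadic (a : ℝ≥0∞) {q : ℝ} (hq : 0 < q) :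
    a ^ q ≤ ∑' k : ℤ, {b : ℝ≥0∞ | 2 ^ k < b}.indicator (fun _ => ((2 : ℝ≥0∞) ^ (k + 1)) ^ q) a := by
  rcases eq_or_ne a 0 with rfl | h0
  · simp [hq]
  rcases eq_or_ne a ∞ with rfl | h1
  -- For `a = ∞` every term with `k ≥ 0` is present and at least `1`, so the sum diverges.
  · have : ∑' k : ℕ, ({b : ℝ≥0∞ | 2 ^ (k : ℤ) < b}.indicator
        (fun _ => ((2 : ℝ≥0∞) ^ ((k : ℤ) + 1)) ^ q) ∞) ≤ _ :=
      ENNReal.tsum_comp_le_tsum_of_injective (f := fun k : ℕ => (k : ℤ)) Nat.cast_injective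
        (fun k : ℤ => {b : ℝ≥0∞ | 2 ^ k < b}.indicator (fun _ => ((2 : ℝ≥0∞) ^ (k + 1)) ^ q) ∞)
    refine le_trans ?_ this
    have h2 : ∑' k : ℕ, (1 : ℝ≥0∞) ≤ ∑' k : ℕ, ({b : ℝ≥0∞ | 2 ^ (k : ℤ) < b}.indicator
        (fun _ => ((2 : ℝ≥0∞) ^ ((k : ℤ) + 1)) ^ q) ∞) := by
      refine ENNReal.tsum_le_tsum fun k => ?_
      rw [indicator_of_mem (by simp)]
      refine ENNReal.one_le_rpow ?_ hq
      have : ((k : ℤ) + 1) = ((k + 1 : ℕ) : ℤ) := by push_cast; ring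
      rw [this, zpow_natCast]
      exact one_le_pow₀ (by norm_num)
    refine le_trans ?_ h2
    rw [ENNReal.tsum_const_eq_top_of_ne_zero one_ne_zero]
    exact le_top
  · obtain ⟨k, hk1, hk2⟩ := ENNReal.exists_mem_Ioc_zpow h0 h1 (y := 2) (by simp) (by simp)
    refine le_trans ?_ (ENNReal.le_tsum k)
    rw [indicator_of_mem (by exact hk1)]
    exact ENNReal.rpow_le_rpow hk2 hq.le

/-- If `2 ^ m < a ≤ 2 ^ (m + 1)`, only `k ≤ m` contribute, and these terms form a geometric series
of ratio `2 ^ (-s)`. -/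
lemma tsum_dyadic_le_rpow {s : ℝ} (hs : 0 < s) : ∃ C : ℝ≥0∞, C ≠ ∞ ∧ ∀ a : ℝ≥0∞,
    ∑' k : ℤ, {b : ℝ≥0∞ | 2 ^ k < b}.indicator (fun _ => ((2 : ℝ≥0∞) ^ k) ^ s) a ≤ C * a ^ s := by
  have hlt : ((2 : ℝ≥0∞)⁻¹) ^ s < 1 := ENNReal.rpow_lt_one (by simp) hs
  refine ⟨(1 - (2⁻¹) ^ s)⁻¹, ?_, fun a => ?_⟩
  · simpa [tsub_eq_zero_iff_le] using hlt
  rcases eq_or_ne a 0 with rfl | h0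
  · simp
  rcases eq_or_ne a ∞ with rfl | h1
  · rw [ENNReal.top_rpow_of_pos hs, ENNReal.mul_top]
    · exact le_top
    · simp
  obtain ⟨m, hm1, hm2⟩ := ENNReal.exists_mem_Ioc_zpow h0 h1 (y := 2) (by simp) (by simp)
  have hinj : Function.Injective (fun j : ℕ => m - (j : ℤ)) := fun i j h => by
    simpa using h
  rw [← hinj.tsum_eq]
  · rw [← ENNReal.tsum_geometric, ← ENNReal.tsum_mul_right]
    refine ENNReal.tsum_le_tsum fun j => (indicator_le_self _ _ _).trans ?_
    rw [sub_eq_add_neg, ENNReal.zpow_add (by simp) (by simp), mul_comm,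
      ENNReal.mul_rpow_of_nonneg _ _ hs.le]
    gcongr
    · rw [ENNReal.zpow_neg, zpow_natCast, ENNReal.inv_pow, ← ENNReal.rpow_natCast,
        ← ENNReal.rpow_natCast, ← ENNReal.rpow_mul, ← ENNReal.rpow_mul, mul_comm]
  · intro k hk
    have hk' : (2 : ℝ≥0∞) ^ k < a := by
      by_contra h
      exact hk (indicator_of_notMem (s := {b : ℝ≥0∞ | 2 ^ k < b}) h _)
    have : k < m + 1 := by
      by_contra! h
      exact absurd (hk'.trans_le hm2) (not_lt.2 (ENNReal.zpow_le_of_le (by norm_num) h))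
    refine ⟨(m - k).toNat, ?_⟩
    have : ((m - k).toNat : ℤ) = m - k := Int.toNat_of_nonneg (by omega)
    simp only [this]; ring

/-! ### Averages -/

section Average

variable {X : Type*} [MeasurableSpace X] {μ : Measure X}

lemma setLAverage_le_mul_of_subset {s t : Set X} {K : ℝ≥0∞} (f : X → ℝ≥0∞) (hst : s ⊆ t)
    (hK : μ t ≤ K * μ s) (hs : μ s ≠ 0) (ht : μ t ≠ ∞) :
    ⨍⁻ z in s, f z ∂μ ≤ K * ⨍⁻ z in t, f z ∂μ := by
  have ht0 : μ t ≠ 0 := fun h => hs (measure_mono_null hst h)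
  have hs0 : μ s ≠ ∞ := fun h => ht (top_unique (h ▸ measure_mono hst))
  rw [setLAverage_eq, setLAverage_eq, ← mul_div_assoc, ENNReal.le_div_iff_mul_le (.inl ht0) (.inl ht)]
  calc (∫⁻ z in s, f z ∂μ) / μ s * μ t ≤ (∫⁻ z in t, f z ∂μ) / μ s * (K * μ s) := by gcongr
    _ = K * (∫⁻ z in t, f z ∂μ) * (μ s / μ s) := by
        simp only [div_eq_mul_inv]; ring
    _ ≤ _ := by rw [ENNReal.div_self hs hs0, mul_one]

lemma setLAverage_const_le (s : Set X) (c : ℝ≥0∞) : ⨍⁻ _ in s, c ∂μ ≤ c := by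
  rw [setLAverage_eq, setLIntegral_const, mul_div_assoc]
  exact mul_le_of_le_one_right' ENNReal.div_self_le_one

lemma setLAverage_mono {s : Set X} {f g : X → ℝ≥0∞} (h : ∀ᵐ z ∂μ, f z ≤ g z) :
    ⨍⁻ z in s, f z ∂μ ≤ ⨍⁻ z in s, g z ∂μ := by
  rw [setLAverage_eq, setLAverage_eq]
  gcongr ?_ / _
  exact lintegral_mono_ae (ae_restrict_of_ae h)

end Average

/-! ### Measures for which the volume of a ball is a power of its radius -/

section Homogeneous

variable {X : Type*} [MetricSpace X] [MeasurableSpace X]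

/-- Every ball of radius `r` has measure `c * r ^ Q`. -/
structure HasBallVolume (μ : Measure X) (c Q : ℝ) : Prop where
  c_pos : 0 < c
  Q_pos : 0 < Q
  measure_ball : ∀ x r, 0 < r → μ (ball x r) = ENNReal.ofReal (c * r ^ Q)

/-- Vitali's covering lemma for a family of balls of bounded radii. -/
lemma exists_disjoint_balls [OpensMeasurableSpace X] [SecondCountableTopology X] {ι : Type*}
    (t : Set ι) (x : ι → X) (r : ι → ℝ)
    (hr : ∀ a ∈ t, 0 < r a) (R : ℝ) (hR : ∀ a ∈ t, r a ≤ R) :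
    ∃ u ⊆ t, u.Countable ∧ u.PairwiseDisjoint (fun a => ball (x a) (r a)) ∧
      ∀ a ∈ t, ∃ b ∈ u, ball (x a) (r a) ⊆ ball (x b) (6 * r b) := by
  obtain ⟨u, hut, hd, hu⟩ := Vitali.exists_disjoint_subfamily_covering_enlargement_ball t x r R hR 6
    (by norm_num)
  refine ⟨u, hut, ?_, hd, hu⟩
  exact hd.countable_of_isOpen (fun _ _ => isOpen_ball) fun a ha => nonempty_ball.2 (hr a (hut ha))

namespace HasBallVolume

variable {μ : Measure X} {c Q : ℝ} (h : HasBallVolume μ c Q)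
include h

lemma measure_ball_ne_zero (x : X) {r : ℝ} (hr : 0 < r) : μ (ball x r) ≠ 0 := by
  rw [h.measure_ball x r hr]
  have := h.c_pos
  simp; positivity

lemma measure_ball_ne_top (x : X) (r : ℝ) : μ (ball x r) ≠ ∞ := by
  rcases le_or_gt r 0 with hr | hr
  · simp [ball_eq_empty.2 hr]
  · simp [h.measure_ball x r hr]

lemma measure_ball_mul (x y : X) {k r : ℝ} (hk : 0 < k) (hr : 0 < r) :
    μ (ball x (k * r)) = ENNReal.ofReal (k ^ Q) * μ (ball y r) := by
  rw [h.measure_ball x _ (by positivity), h.measure_ball y _ hr,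
    ← ENNReal.ofReal_mul (by positivity), Real.mul_rpow hk.le hr.le]
  congr 1; ring

lemma measure_closedBall (x : X) {r : ℝ} (hr : 0 < r) :
    μ (closedBall x r) = μ (ball x r) := by
  refine le_antisymm ?_ (measure_mono ball_subset_closedBall)
  rw [h.measure_ball x r hr]
  have hc : ContinuousAt (fun s : ℝ => ENNReal.ofReal (c * s ^ Q)) r := by
    refine ENNReal.continuous_ofReal.continuousAt.comp ?_
    exact continuousAt_const.mul (Real.continuousAt_rpow_const _ _ (.inl hr.ne'))
  have ht : Tendsto (fun s : ℝ => ENNReal.ofReal (c * s ^ Q)) (𝓝[>] r)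
      (𝓝 (ENNReal.ofReal (c * r ^ Q))) := hc.tendsto.mono_left nhdsWithin_le_nhds
  refine ge_of_tendsto ht ?_
  filter_upwards [self_mem_nhdsWithin] with s hs
  rw [← h.measure_ball x s (hr.trans hs)]
  exact measure_mono (closedBall_subset_ball hs)

lemma isUnifLocDoublingMeasure : IsUnifLocDoublingMeasure μ := by
  refine ⟨⟨Real.toNNReal (2 ^ Q), ?_⟩⟩
  filter_upwards [self_mem_nhdsWithin] with r (hr : 0 < r) x
  rw [h.measure_closedBall x (by positivity), h.measure_closedBall x hr,
    h.measure_ball_mul x x two_pos hr]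
  rfl

lemma isLocallyFiniteMeasure : IsLocallyFiniteMeasure μ :=
  ⟨fun x => ⟨ball x 1, ball_mem_nhds x one_pos, (h.measure_ball_ne_top x 1).lt_top⟩⟩

lemma radius_le_of_measure_le (x : X) {r : ℝ} (hr : 0 < r) {A : ℝ≥0∞} (hA : A ≠ ∞)
    (hrA : μ (ball x r) ≤ A) : r ≤ (A.toReal / c) ^ Q⁻¹ := by
  have hc := h.c_pos
  rw [h.measure_ball x r hr, ENNReal.ofReal_le_iff_le_toReal hA] at hrA
  rw [Real.le_rpow_inv_iff_of_pos hr.le (by positivity) h.Q_pos, le_div_iff₀ hc]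
  linarith

lemma setLAverage_ball_le (f : X → ℝ≥0∞) {x y : X} {k r : ℝ} (hk : 0 < k) (hr : 0 < r)
    (hsub : ball x r ⊆ ball y (k * r)) :
    ⨍⁻ z in ball x r, f z ∂μ ≤ ENNReal.ofReal (k ^ Q) * ⨍⁻ z in ball y (k * r), f z ∂μ :=
  setLAverage_le_mul_of_subset f hsub (h.measure_ball_mul y x hk hr).le
    (h.measure_ball_ne_zero x hr) (h.measure_ball_ne_top _ _)

end HasBallVolume

/-- The uncentered Hardy-Littlewood maximal function. -/
def ballMaximal (μ : Measure X) (f : X → ℝ≥0∞) (z : X) : ℝ≥0∞ :=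
  ⨆ (x : X) (r : ℝ) (_ : 0 < r) (_ : z ∈ ball x r), ⨍⁻ w in ball x r, f w ∂μ

lemma le_ballMaximal (μ : Measure X) (f : X → ℝ≥0∞) {z x : X} {r : ℝ} (hr : 0 < r)
    (hz : z ∈ ball x r) : ⨍⁻ w in ball x r, f w ∂μ ≤ ballMaximal μ f z :=
  le_iSup₂_of_le x r (le_iSup₂_of_le hr hz le_rfl)

lemma lt_ballMaximal_iff {μ : Measure X} {f : X → ℝ≥0∞} {z : X} {t : ℝ≥0∞} :
    t < ballMaximal μ f z ↔
      ∃ x r, 0 < r ∧ z ∈ ball x r ∧ t < ⨍⁻ w in ball x r, f w ∂μ := by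
  simp only [ballMaximal, lt_iSup_iff, exists_prop]

lemma ballMaximal_mono {μ : Measure X} {f g : X → ℝ≥0∞} (hfg : ∀ᵐ z ∂μ, f z ≤ g z) (z : X) :
    ballMaximal μ f z ≤ ballMaximal μ g z :=
  iSup₂_mono fun _ _ => iSup₂_mono fun _ _ => setLAverage_mono hfg

lemma ballMaximal_add_const_le (μ : Measure X) (f : X → ℝ≥0∞) (a : ℝ≥0∞) (z : X) :
    ballMaximal μ (fun w => f w + a) z ≤ ballMaximal μ f z + a := by
  refine iSup₂_le fun x r => iSup₂_le fun hr hz => ?_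
  rw [setLAverage_eq, lintegral_add_right _ measurable_const, ENNReal.add_div, ← setLAverage_eq,
    ← setLAverage_eq]
  exact add_le_add (le_ballMaximal μ f hr hz) (setLAverage_const_le _ _)

lemma lowerSemicontinuous_iSup_mem {Y : Type*} [TopologicalSpace Y] {E : Set Y} (hE : IsOpen E)
    (a : ℝ≥0∞) : LowerSemicontinuous fun z => ⨆ (_ : z ∈ E), a := by
  have : (fun z => ⨆ (_ : z ∈ E), a) = E.indicator fun _ => a := by
    ext z
    by_cases hz : z ∈ E <;> simp [hz]
  rw [this]
  exact hE.lowerSemicontinuous_indicator zero_le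

lemma measurable_ballMaximal [OpensMeasurableSpace X] (μ : Measure X) (f : X → ℝ≥0∞) :
    Measurable (ballMaximal μ f) :=
  LowerSemicontinuous.measurable <| lowerSemicontinuous_iSup fun _ => lowerSemicontinuous_iSup
    fun _ => lowerSemicontinuous_iSup fun _ => lowerSemicontinuous_iSup_mem isOpen_ball _

/-! ### The Hardy-Littlewood maximal theorem. -/

namespace HasBallVolume

variable {μ : Measure X} {c Q : ℝ} [OpensMeasurableSpace X] [SecondCountableTopology X]

/-- The weak type bound. A ball with average above `t` has measure at most `∫ f / t`, which bounds
its radius, so Vitali's lemma applies; the sixfold enlargements of the disjoint balls cover the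
level set. -/
lemma mul_measure_ballMaximal_le (h : HasBallVolume μ c Q) (f : X → ℝ≥0∞) (t : ℝ≥0∞) :
    t * μ {z | t < ballMaximal μ f z} ≤ ENNReal.ofReal (6 ^ Q) * ∫⁻ z, f z ∂μ := by
  rcases eq_or_ne t 0 with rfl | ht
  · simp
  rcases eq_or_ne (∫⁻ z, f z ∂μ) ∞ with hf | hf
  · rw [hf, ENNReal.mul_top]
    · exact le_top
    · simp; positivity
  have hex : ∀ z, t < ballMaximal μ f z → ∃ p : X × ℝ, 0 < p.2 ∧ z ∈ ball p.1 p.2 ∧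
      t < ⨍⁻ w in ball p.1 p.2, f w ∂μ := fun z hz => by
    obtain ⟨x, r, h1⟩ := lt_ballMaximal_iff.1 hz
    exact ⟨(x, r), h1⟩
  choose! p hp0 hpz hpt using hex
  have hmul : ∀ z, t < ballMaximal μ f z →
      t * μ (ball (p z).1 (p z).2) ≤ ∫⁻ w in ball (p z).1 (p z).2, f w ∂μ := fun z hz => by
    have := (hpt z hz).le
    rwa [setLAverage_eq, ENNReal.le_div_iff_mul_le
      (.inl (h.measure_ball_ne_zero _ (hp0 z hz))) (.inl (h.measure_ball_ne_top _ _))] at this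
  obtain ⟨u, hut, huc, hud, hu⟩ := exists_disjoint_balls {z | t < ballMaximal μ f z}
    (fun z => (p z).1) (fun z => (p z).2) hp0
    ((((∫⁻ z, f z ∂μ) / t).toReal / c) ^ Q⁻¹) (fun z hz => by
      refine h.radius_le_of_measure_le (p z).1 (hp0 z hz) (ENNReal.div_ne_top hf ht) ?_
      refine ENNReal.le_div_iff_mul_le (.inl ht) (.inr hf) |>.2 ?_
      rw [mul_comm]
      exact (hmul z hz).trans (setLIntegral_le_lintegral _ _))
  have := huc.to_subtype
  have hcov : {z | t < ballMaximal μ f z} ⊆ ⋃ a : u, ball (p a).1 (6 * (p a).2) := fun z hz => by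
    obtain ⟨b, hb, hsub⟩ := hu z hz
    exact mem_iUnion.2 ⟨⟨b, hb⟩, hsub (hpz z hz)⟩
  calc t * μ {z | t < ballMaximal μ f z}
      ≤ t * ∑' a : u, μ (ball (p a).1 (6 * (p a).2)) := by
        gcongr; exact (measure_mono hcov).trans (measure_iUnion_le _)
    _ = ∑' a : u, ENNReal.ofReal (6 ^ Q) * (t * μ (ball (p a).1 (p a).2)) := by
        rw [← ENNReal.tsum_mul_left]
        refine tsum_congr fun a => ?_
        rw [h.measure_ball_mul _ (p a).1 (by norm_num) (hp0 a (hut a.2))]; ring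
    _ ≤ ∑' a : u, ENNReal.ofReal (6 ^ Q) * ∫⁻ w in ball (p a).1 (p a).2, f w ∂μ :=
        ENNReal.tsum_le_tsum fun a => by gcongr; exact hmul a (hut a.2)
    _ = ENNReal.ofReal (6 ^ Q) * ∫⁻ w in ⋃ a : u, ball (p a).1 (p a).2, f w ∂μ := by
        rw [ENNReal.tsum_mul_left, lintegral_iUnion (fun _ => measurableSet_ball)]
        exact fun a b hab => hud a.2 b.2 (Subtype.coe_injective.ne hab)
    _ ≤ _ := mul_le_mul_right (setLIntegral_le_lintegral _ _) _

/-- Marcinkiewicz truncation: the part of `f` below `t / 2` adds at most `t / 2` to the maximal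
function, so the weak type bound is needed only for the rest. -/
lemma mul_measure_ballMaximal_le_setLIntegral (h : HasBallVolume μ c Q) (f : X → ℝ≥0∞)
    (t : ℝ≥0∞) :
    t * μ {z | t < ballMaximal μ f z} ≤
      2 * ENNReal.ofReal (6 ^ Q) * ∫⁻ z, {b : ℝ≥0∞ | t < 2 * b}.indicator id (f z) ∂μ := by
  set g : X → ℝ≥0∞ := fun z => {b : ℝ≥0∞ | t < 2 * b}.indicator id (f z)
  have hfg : ∀ z, f z ≤ g z + t / 2 := fun z => by
    by_cases hz : t < 2 * f z
    · have : g z = f z := indicator_of_mem (s := {b : ℝ≥0∞ | t < 2 * b}) hz id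
      rw [this]; exact le_self_add
    · refine le_add_left ?_
      rw [ENNReal.le_div_iff_mul_le (by simp) (by simp), mul_comm]
      exact not_lt.1 hz
  have hsub : {z | t < ballMaximal μ f z} ⊆ {z | t / 2 < ballMaximal μ g z} := fun z hz => by
    have h1 : t < ballMaximal μ g z + t / 2 := lt_of_lt_of_le hz
      ((ballMaximal_mono (ae_of_all _ hfg) z).trans (ballMaximal_add_const_le μ g _ z))
    by_contra hcon
    have h2 : ballMaximal μ g z ≤ t / 2 := not_lt.1 hcon
    exact absurd (h1.trans_le (add_le_add_left h2 _)) (by rw [ENNReal.add_halves]; exact lt_irrefl t)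
  calc t * μ {z | t < ballMaximal μ f z} ≤ t * μ {z | t / 2 < ballMaximal μ g z} := by gcongr
    _ = 2 * (t / 2 * μ {z | t / 2 < ballMaximal μ g z}) := by
        rw [← mul_assoc, ENNReal.mul_div_cancel (by simp) (by simp)]
    _ ≤ 2 * (ENNReal.ofReal (6 ^ Q) * ∫⁻ z, g z ∂μ) := by
        exact mul_le_mul_right (h.mul_measure_ballMaximal_le g _) 2
    _ = _ := by ring

/-- The truncated weak type bounds are summed over dyadic levels. After exchanging sum and integral,
the sum over `2 ^ k < 2 f` of `2 ^ (k (q - 1))` is comparable to `f ^ (q - 1)` because `q > 1`. -/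
lemma lintegral_ballMaximal_rpow_le (h : HasBallVolume μ c Q) {q : ℝ} (hq : 1 < q) :
    ∃ C : ℝ≥0∞, C ≠ ∞ ∧ ∀ f : X → ℝ≥0∞, AEMeasurable f μ →
      ∫⁻ z, ballMaximal μ f z ^ q ∂μ ≤ C * ∫⁻ z, f z ^ q ∂μ := by
  obtain ⟨C, hC, hCa⟩ := tsum_dyadic_le_rpow (s := q - 1) (by linarith)
  refine ⟨2 ^ q * (2 * ENNReal.ofReal (6 ^ Q)) * (C * 2 ^ (q - 1)), by finiteness,
    fun f hf => ?_⟩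
  have hmeas := measurable_ballMaximal μ f
  have hms : ∀ k : ℤ, MeasurableSet {b : ℝ≥0∞ | 2 ^ k < b} := fun k => measurableSet_Ioi
  have hms2 : ∀ k : ℤ, MeasurableSet {b : ℝ≥0∞ | 2 ^ k < 2 * b} := fun k =>
    measurableSet_lt measurable_const (measurable_const.mul measurable_id)
  calc ∫⁻ z, ballMaximal μ f z ^ q ∂μ
      ≤ ∫⁻ z, ∑' k : ℤ, {b : ℝ≥0∞ | 2 ^ k < b}.indicator
          (fun _ => ((2 : ℝ≥0∞) ^ (k + 1)) ^ q) (ballMaximal μ f z) ∂μ :=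
        lintegral_mono fun z => rpow_le_tsum_dyadic _ (by linarith)
    _ = ∑' k : ℤ, ((2 : ℝ≥0∞) ^ (k + 1)) ^ q * μ {z | 2 ^ k < ballMaximal μ f z} := by
        rw [lintegral_tsum (f := fun k z => {b : ℝ≥0∞ | 2 ^ k < b}.indicator
          (fun _ => ((2 : ℝ≥0∞) ^ (k + 1)) ^ q) (ballMaximal μ f z)) fun k =>
          ((measurable_const.indicator (hms k)).comp hmeas).aemeasurable]
        refine tsum_congr fun k => ?_
        exact lintegral_indicator_const (hmeas (hms k)) _
    _ ≤ ∑' k : ℤ, 2 ^ q * (2 * ENNReal.ofReal (6 ^ Q)) * ∫⁻ z, f z *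
          {b : ℝ≥0∞ | 2 ^ k < b}.indicator (fun _ => ((2 : ℝ≥0∞) ^ k) ^ (q - 1)) (2 * f z) ∂μ := by
        refine ENNReal.tsum_le_tsum fun k => ?_
        have h0 := two_zpow_ne_zero k
        have h1 := two_zpow_ne_top k
        have e1 : ((2 : ℝ≥0∞) ^ (k + 1)) ^ q = 2 ^ q * ((2 ^ k) ^ (q - 1) * 2 ^ k) := by
          rw [ENNReal.zpow_add (by simp) (by simp), ENNReal.mul_rpow_of_nonneg _ _ (by linarith),
            zpow_one, mul_comm]
          congr 1
          conv_lhs => rw [show q = (q - 1) + 1 by ring, ENNReal.rpow_add _ _ h0 h1,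
            ENNReal.rpow_one]
        have e2 : ∀ z, f z * {b : ℝ≥0∞ | 2 ^ k < b}.indicator
            (fun _ => ((2 : ℝ≥0∞) ^ k) ^ (q - 1)) (2 * f z) =
            (2 ^ k) ^ (q - 1) * {b : ℝ≥0∞ | 2 ^ k < 2 * b}.indicator id (f z) := fun z => by
          by_cases hz : (2 : ℝ≥0∞) ^ k < 2 * f z
          · rw [indicator_of_mem (by exact hz), indicator_of_mem (by exact hz)]
            exact mul_comm _ _
          · rw [indicator_of_notMem (by exact hz), indicator_of_notMem (by exact hz)]
            simp
        simp_rw [e2]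
        rw [lintegral_const_mul' _ _ (by finiteness), e1]
        calc _ = 2 ^ q * (2 ^ k) ^ (q - 1) * (2 ^ k * μ {z | 2 ^ k < ballMaximal μ f z}) := by ring
          _ ≤ 2 ^ q * (2 ^ k) ^ (q - 1) * _ :=
            mul_le_mul_right (h.mul_measure_ballMaximal_le_setLIntegral f _) _
          _ = _ := by ring
    _ = 2 ^ q * (2 * ENNReal.ofReal (6 ^ Q)) * ∫⁻ z, f z * ∑' k : ℤ,
          {b : ℝ≥0∞ | 2 ^ k < b}.indicator (fun _ => ((2 : ℝ≥0∞) ^ k) ^ (q - 1)) (2 * f z) ∂μ := by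
        rw [ENNReal.tsum_mul_left, ← lintegral_tsum]
        · simp_rw [ENNReal.tsum_mul_left]
        · exact fun k => hf.mul
            ((measurable_const.indicator (hms k)).comp_aemeasurable (hf.const_mul 2))
    _ ≤ 2 ^ q * (2 * ENNReal.ofReal (6 ^ Q)) * ∫⁻ z, (C * 2 ^ (q - 1)) * f z ^ q ∂μ := by
        refine mul_le_mul_right (lintegral_mono fun z => ?_) _
        calc f z * _ ≤ f z * (C * (2 * f z) ^ (q - 1)) := by exact mul_le_mul_right (hCa _) _
          _ = C * 2 ^ (q - 1) * (f z ^ (q - 1) * f z) := by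
            rw [ENNReal.mul_rpow_of_nonneg _ _ (by linarith)]; ring
          _ = _ := by
            congr 1
            nth_rewrite 2 [← ENNReal.rpow_one (f z)]
            rw [← ENNReal.rpow_add_of_nonneg _ _ (by linarith) zero_le_one, sub_add_cancel]
    _ = _ := by
        rw [lintegral_const_mul' _ _ (by finiteness)]; ring

end HasBallVolume

end Homogeneous

section Average

variable {X : Type*} [MeasurableSpace X] {μ : Measure X}

lemma enorm_setAverage_sub_le {s : Set X} {b : X → ℝ} (hb : IntegrableOn b s μ) (hs : μ s ≠ 0)
    (hs' : μ s ≠ ∞) (m : ℝ) :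
    ‖⨍ z in s, b z ∂μ - m‖ₑ ≤ ⨍⁻ z in s, ‖b z - m‖ₑ ∂μ := by
  have h1 : ⨍ z in s, b z ∂μ - m = ⨍ z in s, (b z - m) ∂μ := by
    rw [setAverage_eq, setAverage_eq, integral_sub hb (integrableOn_const hs'), smul_sub]
    congr 1
    rw [setIntegral_const, smul_smul, inv_mul_cancel₀, one_smul]
    exact (ENNReal.toReal_pos hs hs').ne'
  rw [h1]
  exact enorm_integral_le_lintegral_enorm _

lemma setLAverage_add_left {s : Set X} {f : X → ℝ≥0∞} (hf : AEMeasurable f (μ.restrict s))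
    (g : X → ℝ≥0∞) :
    ⨍⁻ z in s, (f z + g z) ∂μ = ⨍⁻ z in s, f z ∂μ + ⨍⁻ z in s, g z ∂μ := by
  rw [setLAverage_eq, setLAverage_eq, setLAverage_eq, lintegral_add_left' hf, ENNReal.add_div]

lemma enorm_sub_le_enorm_sub_add (a b c : ℝ) : ‖a - c‖ₑ ≤ ‖a - b‖ₑ + ‖b - c‖ₑ := by
  rw [← sub_add_sub_cancel a b c]
  exact enorm_add_le _ _

end Average

/-! ### Lebesgue points and the John-Nirenberg inequality. -/

section Homogeneous

variable {X : Type*} [MetricSpace X] [MeasurableSpace X] [BorelSpace X] [SecondCountableTopology X]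

namespace HasBallVolume

variable {μ : Measure X} {c Q : ℝ} (h : HasBallVolume μ c Q) {b : X → ℝ}
  (hb : ∀ x r, IntegrableOn b (ball x r) μ)
include h hb

lemma ae_tendsto_setLAverage : ∀ᵐ z ∂μ,
    Tendsto (fun r => ⨍⁻ w in ball z r, ‖b w - b z‖ₑ ∂μ) (𝓝[>] 0) (𝓝 0) := by
  have := h.isUnifLocDoublingMeasure
  have := h.isLocallyFiniteMeasure
  have hloc : LocallyIntegrable b μ := fun x => ⟨ball x 1, ball_mem_nhds x one_pos, hb x 1⟩
  filter_upwards [IsUnifLocDoublingMeasure.ae_tendsto_average_norm_sub μ hloc 1] with z hz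
  have h1 := hz (l := 𝓝[>] (0 : ℝ)) (fun _ => z) id tendsto_id (by
    filter_upwards [self_mem_nhdsWithin] with r (hr : 0 < r)
    exact mem_closedBall_self (by simpa using hr.le))
  have h2 := (ENNReal.continuous_ofReal.tendsto 0).comp h1
  rw [ENNReal.ofReal_zero] at h2
  refine h2.congr' ?_
  filter_upwards [self_mem_nhdsWithin] with r (hr : 0 < r)
  -- Spheres are null sets, so differentiation along closed balls passes to open ones.
  have hae : closedBall z r =ᵐ[μ] ball z r := (ae_eq_of_subset_of_measure_ge ball_subset_closedBall
    (h.measure_closedBall z hr).le measurableSet_ball.nullMeasurableSet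
    (by rw [h.measure_closedBall z hr]; exact h.measure_ball_ne_top _ _)).symm
  have hint : IntegrableOn (fun w => b w - b z) (ball z r) μ :=
    (hb z r).sub (integrableOn_const (h.measure_ball_ne_top _ _))
  simp only [Function.comp_apply, id_eq]
  rw [setAverage_congr hae, ofReal_setAverage hint.norm (ae_of_all _ fun _ => norm_nonneg _),
    setLAverage_eq]
  simp_rw [ofReal_norm]

/-- Only Lebesgue points of `b` are used, so one exceptional null set serves all `m`, `t` and `ρ` at
once. -/
lemma ae_enorm_sub_le_of_setLAverage_le : ∀ᵐ z ∂μ, ∀ (m : ℝ) (t : ℝ≥0∞) (ρ : ℕ → ℝ),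
    (∀ j, 0 < ρ j) → Tendsto ρ atTop (𝓝 0) →
    (∀ j, ⨍⁻ w in ball z (ρ j), ‖b w - m‖ₑ ∂μ ≤ t) → ‖b z - m‖ₑ ≤ t := by
  filter_upwards [h.ae_tendsto_setLAverage hb] with z hz m t ρ hρ0 hρ ht
  have h1 := (hz.comp (tendsto_nhdsWithin_iff.2 ⟨hρ, Eventually.of_forall hρ0⟩)).add_const t
  rw [zero_add] at h1
  refine ge_of_tendsto h1 (Eventually.of_forall fun j => ?_)
  have hne := h.measure_ball_ne_zero z (hρ0 j)
  have hnt := h.measure_ball_ne_top z (ρ j)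
  have hm : AEMeasurable (fun w => ‖b w - b z‖ₑ) (μ.restrict (ball z (ρ j))) :=
    ((hb z (ρ j)).aestronglyMeasurable.aemeasurable.sub_const _).enorm
  calc ‖b z - m‖ₑ = ⨍⁻ _ in ball z (ρ j), ‖b z - m‖ₑ ∂μ := by
        rw [setLAverage_const hne hnt]
    _ ≤ ⨍⁻ w in ball z (ρ j), (‖b w - b z‖ₑ + ‖b w - m‖ₑ) ∂μ := by
        refine setLAverage_mono (ae_of_all _ fun w => ?_)
        have := enorm_sub_le_enorm_sub_add (b z) (b w) m
        rwa [enorm_sub_rev (b z) (b w)] at this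
    _ = _ := setLAverage_add_left hm _
    _ ≤ _ := by
        simp only [Function.comp_apply]
        exact add_le_add_right (ht j) _

/-- The **John-Nirenberg inequality**. -/
lemma measure_oscillation_gt_le {K : ℝ≥0∞} (hK0 : K ≠ 0) (hK : K ≠ ∞)
    (hosc : ∀ x r, 0 < r → ⨍⁻ w in ball x r, ‖b w - ⨍ v in ball x r, b v ∂μ‖ₑ ∂μ ≤ K)
    (k : ℕ) (x : X) {r : ℝ} (hr : 0 < r) :
    μ {z ∈ ball x r | k * (2 * (ENNReal.ofReal (6 ^ Q) * ENNReal.ofReal (2 ^ Q) * K)) <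
      ‖b z - ⨍ v in ball x (2 * r), b v ∂μ‖ₑ} ≤ 2⁻¹ ^ k * μ (ball x r) := by
  -- The factor `6 ^ Q` pays for the Vitali enlargement and `2 ^ Q` for passing from `ball x (2 *
  -- r)` to `ball x r`; the leading `2` makes the enlarged stopping balls fill at most half of `ball
  -- x r`.
  set t : ℝ≥0∞ := 2 * (ENNReal.ofReal (6 ^ Q) * ENNReal.ofReal (2 ^ Q) * K) with ht
  have h6 : (1 : ℝ≥0∞) ≤ ENNReal.ofReal (6 ^ Q) := by
    rw [ENNReal.one_le_ofReal]; exact Real.one_le_rpow (by norm_num) h.Q_pos.le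
  have h2 : (1 : ℝ≥0∞) ≤ ENNReal.ofReal (2 ^ Q) := by
    rw [ENNReal.one_le_ofReal]; exact Real.one_le_rpow (by norm_num) h.Q_pos.le
  have ht0 : t ≠ 0 := by
    rw [ht]; simp only [ne_eq, mul_eq_zero, not_or]
    exact ⟨by simp, ⟨(one_pos.trans_le h6).ne', (one_pos.trans_le h2).ne'⟩, hK0⟩
  have htt : t ≠ ∞ := by finiteness
  have hKt : ENNReal.ofReal (2 ^ Q) * K ≤ t := by
    calc ENNReal.ofReal (2 ^ Q) * K ≤ 2 * (ENNReal.ofReal (6 ^ Q) * (ENNReal.ofReal (2 ^ Q) * K)) :=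
          (le_mul_of_one_le_left' h6).trans (le_mul_of_one_le_left' one_le_two)
      _ = t := by rw [ht]; ring
  induction k generalizing x r with
  | zero =>
    rw [pow_zero, one_mul]
    exact measure_mono fun z hz => hz.1
  | succ k ih =>
    set m := ⨍ v in ball x (2 * r), b v ∂μ
    set g : X → ℝ≥0∞ := fun w => ‖b w - m‖ₑ
    set S : Set X := {z ∈ ball x r | ∃ j : ℕ, t < ⨍⁻ w in ball z ((1 / 12) ^ j * r), g w ∂μ}
    have hsub : ∀ z ∈ ball x r, ball z r ⊆ ball x (2 * r) := fun z hz =>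
      ball_subset_ball' (by rw [mem_ball] at hz; linarith)
    -- Stopping time: `ρ` is the first of the radii `r / 12 ^ j` whose average exceeds `t`, so the
    -- average at `12 * ρ` does not. The scale `j = 0` never stops. The ratio `12 = 2 * 6` makes the
    -- previous ball the one whose mean occurs in the induction hypothesis for the ball enlarged six
    -- times.
    have hex : ∀ z ∈ S, ∃ ρ : ℝ, 0 < ρ ∧ ρ ≤ r ∧ t < ⨍⁻ w in ball z ρ, g w ∂μ ∧
        ⨍⁻ w in ball z (12 * ρ), g w ∂μ ≤ t := by
      rintro z ⟨hz, hj⟩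
      classical
      have hfind := Nat.find_spec hj
      have hmin := fun i => Nat.find_min hj (m := i)
      rcases hn : Nat.find hj with _ | i
      · rw [hn, pow_zero, one_mul] at hfind
        refine absurd hfind (not_lt.2 ?_)
        calc ⨍⁻ w in ball z r, g w ∂μ
            ≤ ENNReal.ofReal (2 ^ Q) * ⨍⁻ w in ball x (2 * r), g w ∂μ :=
              h.setLAverage_ball_le g two_pos hr (hsub z hz)
          _ ≤ ENNReal.ofReal (2 ^ Q) * K := by gcongr; exact hosc x (2 * r) (by positivity)
          _ ≤ t := hKt
      · rw [hn] at hfind hmin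
        refine ⟨(1 / 12) ^ (i + 1) * r, by positivity, ?_, hfind, ?_⟩
        · exact mul_le_of_le_one_left hr.le (pow_le_one₀ (by norm_num) (by norm_num))
        · have := not_lt.1 (hmin i (by omega))
          rwa [show (12 : ℝ) * ((1 / 12) ^ (i + 1) * r) = (1 / 12) ^ i * r by
            rw [pow_succ]; ring]
    choose! ρ hρ0 hρr hρt hρ12 using hex
    obtain ⟨u, huS, huc, hud, hu⟩ := exists_disjoint_balls S id ρ hρ0 r hρr
    simp only [id_eq] at hud hu
    have := huc.to_subtype
    have hsum : ∑' a : u, μ (ball (a : X) (6 * ρ a)) ≤ 2⁻¹ * μ (ball x r) := by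
      have hmul : ∀ a : u, t * μ (ball (a : X) (ρ a)) ≤ ∫⁻ w in ball (a : X) (ρ a), g w ∂μ :=
        fun a => by
          have := (hρt a (huS a.2)).le
          rwa [setLAverage_eq, ENNReal.le_div_iff_mul_le
            (.inl (h.measure_ball_ne_zero _ (hρ0 a (huS a.2))))
            (.inl (h.measure_ball_ne_top _ _))] at this
      have h3 : t * ∑' a : u, μ (ball (a : X) (6 * ρ a)) ≤ t * (2⁻¹ * μ (ball x r)) := by
        calc t * ∑' a : u, μ (ball (a : X) (6 * ρ a))
            = ENNReal.ofReal (6 ^ Q) * ∑' a : u, t * μ (ball (a : X) (ρ a)) := by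
              rw [← ENNReal.tsum_mul_left, ← ENNReal.tsum_mul_left]
              refine tsum_congr fun a => ?_
              rw [h.measure_ball_mul _ (a : X) (by norm_num) (hρ0 a (huS a.2))]; ring
          _ ≤ ENNReal.ofReal (6 ^ Q) * ∑' a : u, ∫⁻ w in ball (a : X) (ρ a), g w ∂μ := by
              gcongr with a; exact hmul a
          _ = ENNReal.ofReal (6 ^ Q) * ∫⁻ w in ⋃ a : u, ball (a : X) (ρ a), g w ∂μ := by
              rw [lintegral_iUnion (fun _ => measurableSet_ball)]
              exact fun a b hab => hud a.2 b.2 (Subtype.coe_injective.ne hab)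
          _ ≤ ENNReal.ofReal (6 ^ Q) * ∫⁻ w in ball x (2 * r), g w ∂μ := by
              gcongr
              exact iUnion_subset fun a => (ball_subset_ball (hρr a (huS a.2))).trans
                (hsub a (huS a.2).1)
          _ ≤ ENNReal.ofReal (6 ^ Q) * (K * μ (ball x (2 * r))) := by
              gcongr
              have := hosc x (2 * r) (by positivity)
              rwa [setLAverage_eq, ENNReal.div_le_iff_le_mul
                (.inl (h.measure_ball_ne_zero _ (by positivity)))
                (.inl (h.measure_ball_ne_top _ _))] at this
          _ = (ENNReal.ofReal (6 ^ Q) * ENNReal.ofReal (2 ^ Q) * K) * μ (ball x r) := by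
              rw [h.measure_ball_mul x x two_pos hr]; ring
          _ = t * (2⁻¹ * μ (ball x r)) := by
              rw [ht, mul_mul_mul_comm, ENNReal.mul_inv_cancel (by simp) (by simp), one_mul]
      exact (ENNReal.mul_le_mul_iff_right ht0 htt).1 h3
    -- Where no scale stops, all averages of `g` are at most `t`, hence so is `g` at almost every
    -- such point.
    have hae : ∀ᵐ z ∂μ, z ∈ ball x r → t < g z → z ∈ S := by
      filter_upwards [h.ae_enorm_sub_le_of_setLAverage_le hb] with z hz hzr hgt
      refine ⟨hzr, ?_⟩
      by_contra! hcon
      refine absurd hgt (not_lt.2 (hz m t (fun j => (1 / 12) ^ j * r) (fun j => by positivity) ?_ hcon))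
      simpa using (tendsto_pow_atTop_nhds_zero_of_lt_one (r := (1 / 12 : ℝ)) (by norm_num)
        (by norm_num)).mul_const r
    have hcov : {z ∈ ball x r | ((k + 1 : ℕ) : ℝ≥0∞) * t < g z} ≤ᵐ[μ]
        (⋃ a : u, {z ∈ ball (a : X) (6 * ρ a) | (k : ℝ≥0∞) * t <
          ‖b z - ⨍ v in ball (a : X) (2 * (6 * ρ a)), b v ∂μ‖ₑ} : Set X) := by
      filter_upwards [hae] with z hz hzk
      obtain ⟨hzr, hzk⟩ : z ∈ ball x r ∧ ((k + 1 : ℕ) : ℝ≥0∞) * t < g z := hzk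
      have hzS : z ∈ S := hz hzr (lt_of_le_of_lt (le_mul_of_one_le_left' (by simp)) hzk)
      obtain ⟨a, ha, hsub'⟩ := hu z hzS
      refine mem_iUnion.2 ⟨⟨a, ha⟩, hsub' (mem_ball_self (hρ0 z hzS)), ?_⟩
      have e12 : 2 * (6 * ρ a) = 12 * ρ a := by ring
      have hpos := hρ0 a (huS ha)
      -- Replacing `m` by the mean over the stopping ball costs one `t`, so a deviation above `(k +
      -- 1) * t` leaves one above `k * t`.
      have h4 : ‖⨍ v in ball a (2 * (6 * ρ a)), b v ∂μ - m‖ₑ ≤ t := by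
        rw [e12]
        exact (enorm_setAverage_sub_le (hb _ _) (h.measure_ball_ne_zero _ (by positivity))
          (h.measure_ball_ne_top _ _) m).trans (hρ12 a (huS ha))
      by_contra! hcon
      refine absurd hzk (not_lt.2 ?_)
      calc g z ≤ _ := enorm_sub_le_enorm_sub_add _ (⨍ v in ball a (2 * (6 * ρ a)), b v ∂μ) _
        _ ≤ k * t + t := add_le_add hcon h4
        _ = _ := by push_cast; ring
    calc _ ≤ _ := measure_mono_ae hcov
      _ ≤ ∑' a : u, 2⁻¹ ^ k * μ (ball (a : X) (6 * ρ a)) :=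
          (measure_iUnion_le _).trans (ENNReal.tsum_le_tsum fun a =>
            ih a (by have := hρ0 a (huS a.2); positivity))
      _ ≤ 2⁻¹ ^ k * (2⁻¹ * μ (ball x r)) := by
          rw [ENNReal.tsum_mul_left]; gcongr
      _ = _ := by rw [pow_succ]; ring

/-- Layers `k t < |b - m| ≤ (k + 1) t` are summed; the factor `2 ^ (-k)` from John-Nirenberg beats
the growth of `(k + 1) ^ s`. -/
lemma lintegral_oscillation_rpow_le {K : ℝ≥0∞} (hK : K ≠ ∞)
    (hosc : ∀ x r, 0 < r → ⨍⁻ w in ball x r, ‖b w - ⨍ v in ball x r, b v ∂μ‖ₑ ∂μ ≤ K)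
    {s : ℝ} (hs : 0 < s) : ∃ C : ℝ≥0∞, C ≠ ∞ ∧ ∀ x r, 0 < r →
      ∫⁻ z in ball x r, ‖b z - ⨍ v in ball x (2 * r), b v ∂μ‖ₑ ^ s ∂μ ≤ C * μ (ball x r) := by
  -- `K + 1` replaces `K` because John-Nirenberg is stated for a nonzero bound.
  have hJN := fun k x r hr => h.measure_oscillation_gt_le hb (K := K + 1) (by simp) (by finiteness)
    (fun x r hr => (hosc x r hr).trans le_self_add) k x (r := r) hr
  set t : ℝ≥0∞ := 2 * (ENNReal.ofReal (6 ^ Q) * ENNReal.ofReal (2 ^ Q) * (K + 1)) with ht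
  have ht0 : t ≠ 0 := by
    rw [ht]; simp; exact ⟨by positivity, by positivity⟩
  have htt : t ≠ ∞ := by finiteness
  refine ⟨∑' k : ℕ, ((k + 1) * t) ^ s * 2⁻¹ ^ k, ?_, fun x r hr => ?_⟩
  · obtain ⟨n, hn⟩ := exists_nat_ge s
    have h1 : Summable fun k : ℕ => ((k + 1 : ℕ) : ℝ≥0) ^ n * 2⁻¹ ^ k := by
      have h2 := (summable_nat_add_iff 1).2
        (summable_pow_mul_geometric_of_norm_lt_one n (r := (2⁻¹ : ℝ)) (by norm_num))
      rw [← NNReal.summable_coe]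
      refine (h2.mul_right 2).congr fun k => ?_
      push_cast
      rw [pow_succ (2⁻¹ : ℝ)]; ring
    have h2 : ∀ k : ℕ, (((k : ℝ≥0∞) + 1) * t) ^ s * 2⁻¹ ^ k ≤
        t ^ s * ((((k + 1 : ℕ) : ℝ≥0) ^ n * 2⁻¹ ^ k : ℝ≥0) : ℝ≥0∞) := fun k => by
      rw [ENNReal.mul_rpow_of_nonneg _ _ hs.le]
      have : ((k : ℝ≥0∞) + 1) ^ s ≤ ((k : ℝ≥0∞) + 1) ^ n := by
        rw [← ENNReal.rpow_natCast]
        exact ENNReal.rpow_le_rpow_of_exponent_le (by simp) hn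
      calc ((k : ℝ≥0∞) + 1) ^ s * t ^ s * 2⁻¹ ^ k ≤ ((k : ℝ≥0∞) + 1) ^ n * t ^ s * 2⁻¹ ^ k := by
            gcongr
        _ = _ := by
            push_cast
            ring
    refine ne_top_of_le_ne_top ?_ (ENNReal.tsum_le_tsum h2)
    rw [ENNReal.tsum_mul_left]
    have := ENNReal.tsum_coe_ne_top_iff_summable.2 h1
    exact ENNReal.mul_ne_top (ENNReal.rpow_ne_top_of_nonneg hs.le htt) this
  · set g : X → ℝ≥0∞ := fun z => ‖b z - ⨍ v in ball x (2 * r), b v ∂μ‖ₑ with hg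
    have hgm : AEMeasurable g (μ.restrict (ball x r)) :=
      ((hb x r).aestronglyMeasurable.aemeasurable.sub_const _).enorm
    have hpt : ∀ z, g z ^ s ≤
        ∑' k : ℕ, {a | k * t < a}.indicator (fun _ => ((k + 1) * t) ^ s) (g z) := fun z => by
      rcases eq_or_ne (g z) 0 with h0 | h0
      · simp [h0, hs]
      have hex : ∃ n : ℕ, g z ≤ n * t := by
        obtain ⟨n, hn⟩ := ENNReal.exists_nat_gt (r := g z / t) (ENNReal.div_ne_top enorm_ne_top ht0)
        exact ⟨n, (ENNReal.div_le_iff ht0 htt).1 hn.le⟩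
      classical
      have hspec := Nat.find_spec hex
      rcases hn : Nat.find hex with _ | k
      · rw [hn] at hspec
        exact absurd (by simpa using hspec) h0
      · rw [hn] at hspec
        have hlt : k * t < g z := not_le.1 (Nat.find_min hex (by omega))
        refine le_trans ?_ (ENNReal.le_tsum k)
        rw [indicator_of_mem (by exact hlt)]
        refine ENNReal.rpow_le_rpow ?_ hs.le
        exact_mod_cast hspec
    have hms : ∀ k : ℕ, MeasurableSet {a : ℝ≥0∞ | k * t < a} := fun k => measurableSet_Ioi
    calc ∫⁻ z in ball x r, g z ^ s ∂μ
        ≤ ∫⁻ z in ball x r, ∑' k : ℕ,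
            {a | k * t < a}.indicator (fun _ => ((k + 1) * t) ^ s) (g z) ∂μ := lintegral_mono hpt
      _ = ∑' k : ℕ, ∫⁻ z in ball x r,
            {a | k * t < a}.indicator (fun _ => ((k + 1) * t) ^ s) (g z) ∂μ :=
          lintegral_tsum fun k => (measurable_const.indicator (hms k)).comp_aemeasurable hgm
      _ ≤ ∑' k : ℕ, ((k + 1) * t) ^ s * 2⁻¹ ^ k * μ (ball x r) := by
          refine ENNReal.tsum_le_tsum fun k => ?_
          have h1 : ∫⁻ z in ball x r,
              {a | k * t < a}.indicator (fun _ => ((k + 1) * t) ^ s) (g z) ∂μ ≤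
              ((k + 1) * t) ^ s * (μ.restrict (ball x r)) {z | k * t < g z} :=
            lintegral_indicator_const_le {z | k * t < g z} _
          refine h1.trans ?_
          rw [mul_assoc, Measure.restrict_apply' measurableSet_ball, inter_comm]
          gcongr
          exact hJN k x r hr
      _ = _ := ENNReal.tsum_mul_right

end HasBallVolume

end Homogeneous

section Average

variable {X : Type*} [MeasurableSpace X] {μ : Measure X}

lemma setLAverage_mono_on {s : Set X} (hs : MeasurableSet s) {f g : X → ℝ≥0∞}
    (h : ∀ᵐ z ∂μ, z ∈ s → f z ≤ g z) : ⨍⁻ z in s, f z ∂μ ≤ ⨍⁻ z in s, g z ∂μ := by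
  rw [setLAverage_eq, setLAverage_eq]
  gcongr ?_ / _
  exact setLIntegral_mono_ae' hs h

lemma setLAverage_const_mul {s : Set X} {a : ℝ≥0∞} (ha : a ≠ ∞) (f : X → ℝ≥0∞) :
    ⨍⁻ z in s, a * f z ∂μ = a * ⨍⁻ z in s, f z ∂μ := by
  rw [setLAverage_eq, setLAverage_eq, lintegral_const_mul' _ _ ha, mul_div_assoc]

lemma setLAverage_mul_le_Lp_mul_Lq {p q : ℝ} (hpq : p.HolderConjugate q) {s : Set X}
    {f g : X → ℝ≥0∞} (hf : AEMeasurable f (μ.restrict s)) (hg : AEMeasurable g (μ.restrict s)) :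
    ⨍⁻ z in s, f z * g z ∂μ ≤
      (⨍⁻ z in s, f z ^ p ∂μ) ^ (1 / p) * (⨍⁻ z in s, g z ^ q ∂μ) ^ (1 / q) :=
  ENNReal.lintegral_mul_le_Lp_mul_Lq _ hpq (hf.smul_measure _) (hg.smul_measure _)

end Average

/-! ### Maximal commutators with functions of bounded mean oscillation. -/

section Homogeneous

variable {X : Type*} [MetricSpace X] [MeasurableSpace X]

/-- The maximal commutator `z ↦ sup_{B ∋ z} ⨍_B |b z - b w| f w dw`. -/
def maximalCommutator (μ : Measure X) (b : X → ℝ) (f : X → ℝ≥0∞) (z : X) : ℝ≥0∞ :=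
  ⨆ (x : X) (r : ℝ) (_ : 0 < r) (_ : z ∈ ball x r), ⨍⁻ w in ball x r, ‖b z - b w‖ₑ * f w ∂μ

lemma le_maximalCommutator (μ : Measure X) (b : X → ℝ) (f : X → ℝ≥0∞) {z x : X} {r : ℝ}
    (hr : 0 < r) (hz : z ∈ ball x r) :
    ⨍⁻ w in ball x r, ‖b z - b w‖ₑ * f w ∂μ ≤ maximalCommutator μ b f z :=
  le_iSup₂_of_le x r (le_iSup₂_of_le hr hz le_rfl)

/-- Boundedness of the maximal commutator from `L^r` to `L^q`. -/
def MaximalCommutatorBounded (μ : Measure X) (b : X → ℝ) (r q : ℝ) : Prop :=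
  ∃ C : ℝ≥0∞, C ≠ ∞ ∧ ∀ f : X → ℝ≥0∞, AEMeasurable f μ →
    (∫⁻ z, maximalCommutator μ b f z ^ q ∂μ) ^ (1 / q) ≤ C * (∫⁻ z, f z ^ r ∂μ) ^ (1 / r)

lemma locallyIntegrable_of_integrableOn_ball {μ : Measure X} {b : X → ℝ}
    (hb : ∀ x r, IntegrableOn b (ball x r) μ) : LocallyIntegrable b μ :=
  fun x => ⟨ball x 1, ball_mem_nhds x one_pos, hb x 1⟩

variable [BorelSpace X] [SecondCountableTopology X]

namespace HasBallVolume

variable {μ : Measure X} {c Q : ℝ} (h : HasBallVolume μ c Q)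
include h

omit [BorelSpace X] [SecondCountableTopology X] in
-- In a general metric space an inclusion of balls does not order the radii; here the measures do.
lemma radius_le_of_subset {x y : X} {r s : ℝ} (hr : 0 < r) (hsub : ball x r ⊆ ball y s) :
    r ≤ s := by
  by_contra! hlt
  have hs : 0 < s := by
    by_contra! hs
    rw [ball_eq_empty.2 hs] at hsub
    exact hsub (mem_ball_self hr)
  have h1 := measure_mono (μ := μ) hsub
  have hc := h.c_pos
  rw [h.measure_ball x r hr, h.measure_ball y s hs, ENNReal.ofReal_le_ofReal_iff (by positivity)] at h1
  have h2 := Real.rpow_lt_rpow hs.le hlt h.Q_pos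
  nlinarith

/-- A Vitali covering of the level set that also captures the double of every ball through `z` with
average above `t`. At each `z` a ball is chosen whose radius exceeds half the supremum of the
competing radii; this is finite since all such balls lie in the level set. -/
lemma exists_cover_ballMaximal (f : X → ℝ≥0∞) (t : ℝ≥0∞)
    (hfin : μ {z | t < ballMaximal μ f z} ≠ ∞) :
    ∃ (u : Set X) (x : X → X) (r : X → ℝ), u.Countable ∧ (∀ j ∈ u, 0 < r j) ∧
      ∑' j : u, μ (ball (x j) (r j)) ≤ μ {z | t < ballMaximal μ f z} ∧
      ∀ z, t < ballMaximal μ f z → ∃ j ∈ u, z ∈ ball (x j) (42 * r j) ∧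
        ∀ y s, 0 < s → z ∈ ball y s → t < ⨍⁻ w in ball y s, f w ∂μ →
          ball y (2 * s) ⊆ ball (x j) (42 * r j) := by
  have hballs : ∀ y s, t < ⨍⁻ w in ball y s, f w ∂μ → 0 < s →
      ball y s ⊆ {z | t < ballMaximal μ f z} := fun y s hlt hs w hw =>
    hlt.trans_le (le_ballMaximal μ f hs hw)
  set R := ((μ {z | t < ballMaximal μ f z}).toReal / c) ^ Q⁻¹
  have hR : ∀ y s, 0 < s → t < ⨍⁻ w in ball y s, f w ∂μ → s ≤ R := fun y s hs hlt =>
    h.radius_le_of_measure_le y hs hfin (measure_mono (hballs y s hlt hs))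
  have hex : ∀ z, t < ballMaximal μ f z → ∃ p : X × ℝ, 0 < p.2 ∧ z ∈ ball p.1 p.2 ∧
      t < ⨍⁻ w in ball p.1 p.2, f w ∂μ ∧
      ∀ y s, 0 < s → z ∈ ball y s → t < ⨍⁻ w in ball y s, f w ∂μ → s ≤ 2 * p.2 := by
    intro z hz
    set A : Set ℝ := {s | 0 < s ∧ ∃ y, z ∈ ball y s ∧ t < ⨍⁻ w in ball y s, f w ∂μ}
    obtain ⟨x0, r0, hr0, hz0, ht0⟩ := lt_ballMaximal_iff.1 hz
    have hA0 : r0 ∈ A := ⟨hr0, x0, hz0, ht0⟩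
    have hAb : BddAbove A := ⟨R, fun s hs => by
      obtain ⟨hs0, y, _, hy⟩ := hs
      exact hR y s hs0 hy⟩
    have hpos : 0 < sSup A := hr0.trans_le (le_csSup hAb hA0)
    obtain ⟨s, ⟨hs0, y, hzy, hty⟩, hs⟩ := exists_lt_of_lt_csSup ⟨r0, hA0⟩ (half_lt_self hpos)
    refine ⟨(y, s), hs0, hzy, hty, fun y' s' hs' hz' ht' => ?_⟩
    have := le_csSup hAb (show s' ∈ A from ⟨hs', y', hz', ht'⟩)
    simp only
    linarith
  choose! p hp0 hpz hpt hpmax using hex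
  obtain ⟨u, hut, huc, hud, hu⟩ := exists_disjoint_balls {z | t < ballMaximal μ f z}
    (fun z => (p z).1) (fun z => (p z).2) hp0 R (fun z hz => hR _ _ (hp0 z hz) (hpt z hz))
  refine ⟨u, fun z => (p z).1, fun z => (p z).2, huc, fun j hj => hp0 j (hut hj), ?_, ?_⟩
  · have := huc.to_subtype
    rw [← measure_iUnion (fun (a b : u) hab => hud a.2 b.2 (Subtype.coe_injective.ne hab))
      (fun _ => measurableSet_ball)]
    exact measure_mono (iUnion_subset fun a => hballs _ _ (hpt a (hut a.2)) (hp0 a (hut a.2)))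
  · intro z hz
    obtain ⟨j, hj, hsub⟩ := hu z hz
    have hj0 := hp0 j (hut hj)
    have hzj := hsub (hpz z hz)
    refine ⟨j, hj, ball_subset_ball (by linarith) hzj, fun y s hs hzy hty w hw => ?_⟩
    have h1 := hpmax z hz y s hs hzy hty
    have h2 := h.radius_le_of_subset (hp0 z hz) hsub
    rw [mem_ball] at hzj hzy hw ⊢
    -- With `ρ` the radius chosen at `z` and `r` that of the covering ball, `s ≤ 2 * ρ ≤ 12 * r`, so
    -- the distance is below `2 * s + s + 6 * r ≤ 42 * r`.
    have h3 := dist_triangle4 w y z (p j).1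
    rw [dist_comm y z] at h3
    linarith

variable {b : X → ℝ} (hb : ∀ x r, IntegrableOn b (ball x r) μ)
include hb

/-- The maximal function of the localized oscillation dominates, at `z`, the distance from the fixed
mean to the mean over any smaller ball through `z`. The bound combines the moments of the
oscillation with the maximal theorem. -/
lemma lintegral_oscillation_add_ballMaximal_rpow_le {K : ℝ≥0∞} (hK : K ≠ ∞)
    (hosc : ∀ x r, 0 < r → ⨍⁻ w in ball x r, ‖b w - ⨍ v in ball x r, b v ∂μ‖ₑ ∂μ ≤ K)
    {q : ℝ} (hq : 1 < q) : ∃ C : ℝ≥0∞, C ≠ ∞ ∧ ∀ x r, 0 < r →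
      ∫⁻ z in ball x r, (‖b z - ⨍ v in ball x (2 * r), b v ∂μ‖ₑ +
        ballMaximal μ ((ball x r).indicator fun w => ‖b w - ⨍ v in ball x (2 * r), b v ∂μ‖ₑ) z) ^ q
        ∂μ ≤ C * μ (ball x r) := by
  obtain ⟨C₁, hC₁, hJ⟩ := h.lintegral_oscillation_rpow_le hb hK hosc (s := q) (by linarith)
  obtain ⟨C₂, hC₂, hM⟩ := h.lintegral_ballMaximal_rpow_le hq
  refine ⟨2 ^ (q - 1) * (C₁ + C₂ * C₁), by finiteness, fun x r hr => ?_⟩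
  have hbm : AEMeasurable b μ :=
    (locallyIntegrable_of_integrableOn_ball hb).aestronglyMeasurable.aemeasurable
  set m := ⨍ v in ball x (2 * r), b v ∂μ
  have hgm : AEMeasurable (fun w => ‖b w - m‖ₑ) μ := (hbm.sub_const _).enorm
  set g : X → ℝ≥0∞ := (ball x r).indicator fun w => ‖b w - m‖ₑ
  have hg : ∫⁻ z, g z ^ q ∂μ = ∫⁻ z in ball x r, ‖b z - m‖ₑ ^ q ∂μ := by
    rw [← lintegral_indicator measurableSet_ball]
    congr 1 with z
    by_cases hz : z ∈ ball x r
    · simp only [g, indicator_of_mem hz]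
    · simp only [g, indicator_of_notMem hz]
      exact ENNReal.zero_rpow_of_pos (by linarith)
  calc _ ≤ ∫⁻ z in ball x r, 2 ^ (q - 1) * (‖b z - m‖ₑ ^ q + ballMaximal μ g z ^ q) ∂μ :=
        lintegral_mono fun z => ENNReal.rpow_add_le_mul_rpow_add_rpow _ _ hq.le
    _ = 2 ^ (q - 1) * (∫⁻ z in ball x r, ‖b z - m‖ₑ ^ q ∂μ +
          ∫⁻ z in ball x r, ballMaximal μ g z ^ q ∂μ) := by
        rw [lintegral_const_mul' _ _ (by finiteness),
          lintegral_add_left' (hgm.pow_const q).restrict]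
    _ ≤ 2 ^ (q - 1) * (C₁ * μ (ball x r) + C₂ * (C₁ * μ (ball x r))) := by
        gcongr
        · exact hJ x r hr
        · refine (setLIntegral_le_lintegral _ _).trans
            ((hM g (hgm.indicator measurableSet_ball)).trans ?_)
          rw [hg]
          gcongr
          exact hJ x r hr
    _ = _ := by ring

/-- The mean subtracted from `b z` varies with the competing ball, so it is compared with the means
over fixed covering balls. A competing ball with average in `(2 ^ k, 2 ^ (k + 1)]` has its double
inside a covering ball of level `k`, so its contribution is at most `2 ^ (k + 1)` times the majorant
of the preceding lemma there. Integrating and summing leaves `∑ 2 ^ (k q) μ {M f > 2 ^ k}`,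
comparable to `∫ (M f) ^ q`. -/
lemma lintegral_iSup_oscillation_mul_rpow_le {K : ℝ≥0∞} (hK : K ≠ ∞)
    (hosc : ∀ x r, 0 < r → ⨍⁻ w in ball x r, ‖b w - ⨍ v in ball x r, b v ∂μ‖ₑ ∂μ ≤ K)
    {q : ℝ} (hq : 1 < q) : ∃ C : ℝ≥0∞, C ≠ ∞ ∧ ∀ f : X → ℝ≥0∞, AEMeasurable f μ →
      ∫⁻ z, (⨆ (x : X) (r : ℝ) (_ : 0 < r) (_ : z ∈ ball x r),
        ‖b z - ⨍ v in ball x (2 * r), b v ∂μ‖ₑ * ⨍⁻ w in ball x r, f w ∂μ) ^ q ∂μ ≤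
      C * ∫⁻ z, f z ^ q ∂μ := by
  have hq0 : 0 < q := by linarith
  obtain ⟨C₁, hC₁, hJ⟩ := h.lintegral_oscillation_add_ballMaximal_rpow_le hb hK hosc hq
  obtain ⟨C₂, hC₂, hM⟩ := h.lintegral_ballMaximal_rpow_le hq
  obtain ⟨C₃, hC₃, hD⟩ := tsum_dyadic_le_rpow hq0
  -- The summand `1` keeps the constant nonzero, which settles the case of an infinite right-hand
  -- side.
  refine ⟨C₁ * ENNReal.ofReal (42 ^ Q) * 2 ^ q * C₃ * C₂ + 1, by finiteness, fun f hf => ?_⟩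
  rcases eq_or_ne (∫⁻ z, f z ^ q ∂μ) ∞ with hfi | hfi
  · rw [hfi, ENNReal.mul_top (by simp)]; exact le_top
  have hMm := measurable_ballMaximal μ f
  have hMfin : ∫⁻ z, ballMaximal μ f z ^ q ∂μ ≠ ∞ :=
    ne_top_of_le_ne_top (by finiteness) (hM f hf)
  have hlev : ∀ k : ℤ, μ {z | 2 ^ k < ballMaximal μ f z} ≠ ∞ := fun k => by
    have h1 := meas_ge_le_lintegral_div (hMm.pow_const q).aemeasurable
      (ε := ((2 : ℝ≥0∞) ^ k) ^ q) (μ := μ)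
      (ENNReal.rpow_pos (two_zpow_ne_zero k).bot_lt (two_zpow_ne_top k)).ne'
      (ENNReal.rpow_ne_top_of_nonneg hq0.le (two_zpow_ne_top k))
    refine ne_top_of_le_ne_top (ENNReal.div_ne_top hMfin
      (ENNReal.rpow_pos (two_zpow_ne_zero k).bot_lt (two_zpow_ne_top k)).ne')
      (le_trans (measure_mono fun z hz => ?_) h1)
    exact ENNReal.rpow_le_rpow (le_of_lt hz) hq0.le
  choose u x r huc hr0 hsum hcov using fun k : ℤ => h.exists_cover_ballMaximal f (2 ^ k) (hlev k)
  have hbm : AEMeasurable b μ :=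
    (locallyIntegrable_of_integrableOn_ball hb).aestronglyMeasurable.aemeasurable
  set m : ℤ → X → ℝ := fun k j => ⨍ v in ball (x k j) (2 * (42 * r k j)), b v ∂μ
  set G : ℤ → X → X → ℝ≥0∞ := fun k j z => ‖b z - m k j‖ₑ +
    ballMaximal μ ((ball (x k j) (42 * r k j)).indicator fun w => ‖b w - m k j‖ₑ) z
  have hGm : ∀ k j, AEMeasurable (G k j) μ := fun k j =>
    (hbm.sub_const _).enorm.add (measurable_ballMaximal μ _).aemeasurable
  set S : X → ℝ≥0∞ := fun z => ∑' k : ℤ, ∑' j : u k, (ball (x k j) (42 * r k j)).indicator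
    (fun z => ((2 : ℝ≥0∞) ^ (k + 1)) ^ q * G k j z ^ q) z with hS
  have hpt : ∀ᵐ z ∂μ, (⨆ (x : X) (r : ℝ) (_ : 0 < r) (_ : z ∈ ball x r),
        ‖b z - ⨍ v in ball x (2 * r), b v ∂μ‖ₑ * ⨍⁻ w in ball x r, f w ∂μ) ^ q ≤ S z := by
    have hfin := ae_lt_top' (hMm.pow_const q).aemeasurable hMfin
    filter_upwards [hfin] with z hz
    have hz' : ballMaximal μ f z ≠ ∞ := fun hcon => by
      rw [hcon, ENNReal.top_rpow_of_pos hq0] at hz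
      exact lt_irrefl _ hz
    rw [← ENNReal.le_rpow_inv_iff hq0]
    refine iSup₂_le fun y s => iSup₂_le fun hs hzy => ?_
    rw [ENNReal.le_rpow_inv_iff hq0]
    set a := ⨍⁻ w in ball y s, f w ∂μ with ha
    rcases eq_or_ne a 0 with ha0 | ha0
    · simp [ha0, hq0]
    have hat : a ≠ ∞ := ne_top_of_le_ne_top hz' (le_ballMaximal μ f hs hzy)
    obtain ⟨k, hk1, hk2⟩ := ENNReal.exists_mem_Ioc_zpow ha0 hat (y := 2) (by simp) (by simp)
    obtain ⟨j, hj, hzj, hsub⟩ := hcov k z (hk1.trans_le (le_ballMaximal μ f hs hzy))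
    have hsub := hsub y s hs hzy hk1
    -- The mean over `ball y (2 * s)` differs from `m k j` by at most an average of `|b - m k j|`
    -- over a ball that contains `z` and lies inside the covering ball.
    have hG : ‖b z - ⨍ v in ball y (2 * s), b v ∂μ‖ₑ ≤ G k j z := by
      refine (enorm_sub_le_enorm_sub_add _ (m k j) _).trans ?_
      rw [enorm_sub_rev (m k j)]
      refine add_le_add_right ?_ _
      have h2s : (0 : ℝ) < 2 * s := by positivity
      refine (enorm_setAverage_sub_le (hb _ _) (h.measure_ball_ne_zero _ h2s)
        (h.measure_ball_ne_top _ _) _).trans ?_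
      refine le_trans ?_ (le_ballMaximal μ _ h2s (ball_subset_ball (by linarith) hzy))
      refine setLAverage_mono_on measurableSet_ball (ae_of_all _ fun w hw => ?_)
      rw [indicator_of_mem (hsub hw)]
    refine le_trans ?_ (ENNReal.le_tsum k)
    refine le_trans ?_ (ENNReal.le_tsum (⟨j, hj⟩ : u k))
    rw [indicator_of_mem hzj, ← ENNReal.mul_rpow_of_nonneg _ _ hq0.le, mul_comm]
    gcongr
  have hterm : ∀ k (j : u k), ∫⁻ z, (ball (x k j) (42 * r k j)).indicator
      (fun z => ((2 : ℝ≥0∞) ^ (k + 1)) ^ q * G k j z ^ q) z ∂μ ≤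
      C₁ * ENNReal.ofReal (42 ^ Q) * ((2 : ℝ≥0∞) ^ (k + 1)) ^ q * μ (ball (x k j) (r k j)) :=
    fun k j => by
      have hr := hr0 k j j.2
      rw [lintegral_indicator measurableSet_ball, lintegral_const_mul' _ _
        (ENNReal.rpow_ne_top_of_nonneg hq0.le (two_zpow_ne_top _))]
      calc _ ≤ ((2 : ℝ≥0∞) ^ (k + 1)) ^ q * (C₁ * μ (ball (x k j) (42 * r k j))) :=
            mul_le_mul_right (hJ (x k j) (42 * r k j) (by positivity)) _
        _ = _ := by
            rw [h.measure_ball_mul _ (x k j) (by norm_num) hr]; ring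
  calc _ ≤ ∫⁻ z, S z ∂μ := lintegral_mono_ae hpt
    _ = ∑' k : ℤ, ∑' j : u k, ∫⁻ z, (ball (x k j) (42 * r k j)).indicator
          (fun z => ((2 : ℝ≥0∞) ^ (k + 1)) ^ q * G k j z ^ q) z ∂μ := by
        have hm : ∀ k (j : u k), AEMeasurable (fun z => (ball (x k j) (42 * r k j)).indicator
            (fun z => ((2 : ℝ≥0∞) ^ (k + 1)) ^ q * G k j z ^ q) z) μ := fun k j =>
          (((hGm k j).pow_const q).const_mul _).indicator measurableSet_ball
        have := fun k => (huc k).to_subtype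
        rw [lintegral_tsum fun k => AEMeasurable.tsum (hm k)]
        exact tsum_congr fun k => lintegral_tsum (hm k)
    _ ≤ ∑' k : ℤ, C₁ * ENNReal.ofReal (42 ^ Q) * ((2 : ℝ≥0∞) ^ (k + 1)) ^ q *
          μ {z | 2 ^ k < ballMaximal μ f z} := by
        refine ENNReal.tsum_le_tsum fun k => (ENNReal.tsum_le_tsum (hterm k)).trans ?_
        rw [ENNReal.tsum_mul_left]
        exact mul_le_mul_right (hsum k) _
    _ = C₁ * ENNReal.ofReal (42 ^ Q) * 2 ^ q * ∫⁻ z, ∑' k : ℤ,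
          {a : ℝ≥0∞ | 2 ^ k < a}.indicator (fun _ => ((2 : ℝ≥0∞) ^ k) ^ q) (ballMaximal μ f z) ∂μ := by
        have hms : ∀ k : ℤ, MeasurableSet {b : ℝ≥0∞ | 2 ^ k < b} := fun k => measurableSet_Ioi
        rw [lintegral_tsum (f := fun k z => {b : ℝ≥0∞ | 2 ^ k < b}.indicator
          (fun _ => ((2 : ℝ≥0∞) ^ k) ^ q) (ballMaximal μ f z)) fun k =>
          ((measurable_const.indicator (hms k)).comp hMm).aemeasurable, ← ENNReal.tsum_mul_left]
        refine tsum_congr fun k => ?_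
        have : ∫⁻ z, {b : ℝ≥0∞ | 2 ^ k < b}.indicator (fun _ => ((2 : ℝ≥0∞) ^ k) ^ q)
            (ballMaximal μ f z) ∂μ = ((2 : ℝ≥0∞) ^ k) ^ q * μ {z | 2 ^ k < ballMaximal μ f z} :=
          lintegral_indicator_const (hMm (hms k)) _
        rw [this, ENNReal.zpow_add (by simp) (by simp), ENNReal.mul_rpow_of_nonneg _ _ hq0.le, zpow_one]
        ring
    _ ≤ C₁ * ENNReal.ofReal (42 ^ Q) * 2 ^ q * ∫⁻ z, C₃ * ballMaximal μ f z ^ q ∂μ :=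
        mul_le_mul_right (lintegral_mono fun z => hD _) _
    _ ≤ C₁ * ENNReal.ofReal (42 ^ Q) * 2 ^ q * (C₃ * (C₂ * ∫⁻ z, f z ^ q ∂μ)) := by
        rw [lintegral_const_mul' _ _ hC₃]
        gcongr
        exact hM f hf
    _ ≤ _ := by
        rw [add_mul]
        exact le_add_right (le_of_eq (by ring))

/-- The maximal commutator with a function of bounded mean oscillation is bounded on `L^q`. -/
lemma maximalCommutatorBounded_of_oscillation_le {K : ℝ≥0∞} (hK : K ≠ ∞)
    (hosc : ∀ x r, 0 < r → ⨍⁻ w in ball x r, ‖b w - ⨍ v in ball x r, b v ∂μ‖ₑ ∂μ ≤ K)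
    {q : ℝ} (hq : 1 < q) : MaximalCommutatorBounded μ b q q := by
  have hq0 : 0 < q := by linarith
  -- Any exponent strictly between `1` and `q` would do: Hölder with `s` costs a moment of the
  -- oscillation, and the maximal operator is still bounded on `L^(q / s)`.
  set s := (1 + q) / 2 with hs
  have hs1 : 1 < s := by rw [hs]; linarith
  have hs0 : 0 < s := by linarith
  have hsq : 1 < q / s := by rw [one_lt_div hs0, hs]; linarith
  have hconj := (Real.HolderConjugate.conjExponent hs1).symm
  set s' := s.conjExponent
  obtain ⟨C₁, hC₁, hT⟩ := h.lintegral_iSup_oscillation_mul_rpow_le hb hK hosc hq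
  obtain ⟨C₂, hC₂, hM⟩ := h.lintegral_ballMaximal_rpow_le hsq
  obtain ⟨C₃, hC₃, hJ⟩ := h.lintegral_oscillation_rpow_le hb hK hosc hconj.pos
  have hA : C₃ ^ (1 / s') ≠ ∞ := ENNReal.rpow_ne_top_of_nonneg hconj.one_div_nonneg hC₃
  set A := C₃ ^ (1 / s')
  refine ⟨(2 ^ (q - 1) * (A ^ q * C₂ + C₁)) ^ (1 / q), by finiteness, fun f hf => ?_⟩
  rw [← ENNReal.mul_rpow_of_nonneg _ _ (by positivity)]
  refine ENNReal.rpow_le_rpow ?_ (by positivity)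
  have hbm : AEMeasurable b μ :=
    (locallyIntegrable_of_integrableOn_ball hb).aestronglyMeasurable.aemeasurable
  set T : X → ℝ≥0∞ := fun z => ⨆ (x : X) (r : ℝ) (_ : 0 < r) (_ : z ∈ ball x r),
        ‖b z - ⨍ v in ball x (2 * r), b v ∂μ‖ₑ * ⨍⁻ w in ball x r, f w ∂μ
  have hpt : ∀ z, maximalCommutator μ b f z ≤
      A * ballMaximal μ (fun w => f w ^ s) z ^ (1 / s) + T z := by
    refine fun z => iSup₂_le fun x r => iSup₂_le fun hr hz => ?_
    set m := ⨍ v in ball x (2 * r), b v ∂μ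
    have hm : AEMeasurable (fun w => ‖b w - m‖ₑ) μ := (hbm.sub_const _).enorm
    calc ⨍⁻ w in ball x r, ‖b z - b w‖ₑ * f w ∂μ
        ≤ ⨍⁻ w in ball x r, (‖b w - m‖ₑ * f w + ‖b z - m‖ₑ * f w) ∂μ := by
          refine setLAverage_mono (ae_of_all _ fun w => ?_)
          rw [← add_mul]
          gcongr
          have := enorm_sub_le_enorm_sub_add (b z) m (b w)
          rwa [add_comm, enorm_sub_rev m] at this
      _ = ⨍⁻ w in ball x r, ‖b w - m‖ₑ * f w ∂μ + ‖b z - m‖ₑ * ⨍⁻ w in ball x r, f w ∂μ := by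
          rw [setLAverage_add_left (f := fun w => ‖b w - m‖ₑ * f w) (hm.mul hf).restrict, setLAverage_const_mul enorm_ne_top]
      _ ≤ _ := by
          refine add_le_add ?_ (le_iSup₂_of_le x r (le_iSup₂_of_le hr hz le_rfl))
          refine (setLAverage_mul_le_Lp_mul_Lq hconj hm.restrict hf.restrict).trans ?_
          refine mul_le_mul' (ENNReal.rpow_le_rpow ?_ hconj.one_div_nonneg)
            (ENNReal.rpow_le_rpow ?_ (by positivity))
          · rw [setLAverage_eq, ENNReal.div_le_iff (h.measure_ball_ne_zero _ hr)
              (h.measure_ball_ne_top _ _)]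
            exact hJ x r hr
          · exact le_ballMaximal μ (fun w => f w ^ s) hr hz
  calc ∫⁻ z, maximalCommutator μ b f z ^ q ∂μ
      ≤ ∫⁻ z, 2 ^ (q - 1) * (A ^ q * ballMaximal μ (fun w => f w ^ s) z ^ (q / s) + T z ^ q) ∂μ := by
        refine lintegral_mono fun z => ?_
        refine (ENNReal.rpow_le_rpow (hpt z) hq0.le).trans
          ((ENNReal.rpow_add_le_mul_rpow_add_rpow _ _ hq.le).trans_eq ?_)
        rw [ENNReal.mul_rpow_of_nonneg _ _ hq0.le, ← ENNReal.rpow_mul (ballMaximal μ _ z),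
          one_div_mul_eq_div]
    _ = 2 ^ (q - 1) * (A ^ q * ∫⁻ z, ballMaximal μ (fun w => f w ^ s) z ^ (q / s) ∂μ +
          ∫⁻ z, T z ^ q ∂μ) := by
        rw [lintegral_const_mul' _ _ (by finiteness), lintegral_add_left
          (((measurable_ballMaximal μ _).pow_const _).const_mul _),
          lintegral_const_mul' _ _ (by finiteness)]
    _ ≤ 2 ^ (q - 1) * (A ^ q * (C₂ * ∫⁻ z, f z ^ q ∂μ) + C₁ * ∫⁻ z, f z ^ q ∂μ) := by
        gcongr
        · refine (hM _ (hf.pow_const s)).trans_eq ?_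
          simp_rw [← ENNReal.rpow_mul, mul_div_cancel₀ q hs0.ne']
        · exact hT f hf
    _ = _ := by ring

end HasBallVolume

end Homogeneous

/-! ### Maximal commutators with Campanato functions of positive order. -/

section Homogeneous

variable {X : Type*} [MetricSpace X] [MeasurableSpace X] [BorelSpace X] [SecondCountableTopology X]

namespace HasBallVolume

variable {μ : Measure X} {c Q : ℝ} (h : HasBallVolume μ c Q)
include h

section Campanato

variable {b : X → ℝ} (hb : ∀ x r, IntegrableOn b (ball x r) μ) {K : ℝ≥0∞} (hK : K ≠ ∞) {β : ℝ}
  (hβ : 0 < β)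
  (hosc : ∀ x r, 0 < r →
    ⨍⁻ w in ball x r, ‖b w - ⨍ v in ball x r, b v ∂μ‖ₑ ∂μ ≤ K * μ (ball x r) ^ β)
include hb hK hβ hosc

/-- Campanato functions of positive order are almost everywhere Hölder continuous. -/
lemma ae_enorm_sub_setAverage_le : ∃ C : ℝ≥0∞, C ≠ ∞ ∧ ∀ᵐ z ∂μ, ∀ x r, 0 < r → z ∈ ball x r →
    ‖b z - ⨍ v in ball x r, b v ∂μ‖ₑ ≤ C * μ (ball x r) ^ β := by
  set D := ENNReal.ofReal (2 ^ Q)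
  -- `θ` is the factor by which `μ (ball z r) ^ β` shrinks when the radius is halved. As `θ < 1`,
  -- the differences of successive means over `ball z (2 ^ (-j) * 2 * r)` are summable, and at a
  -- Lebesgue point these means tend to `b z`.
  set θ : ℝ≥0∞ := ENNReal.ofReal ((1 / 2) ^ Q) ^ β
  have hθ : θ < 1 := by
    refine ENNReal.rpow_lt_one ?_ hβ
    rw [ENNReal.ofReal_lt_one]
    exact Real.rpow_lt_one (by norm_num) (by norm_num) h.Q_pos
  have hθ' : (1 - θ)⁻¹ ≠ ∞ := by simpa [tsub_eq_zero_iff_le] using hθ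
  refine ⟨(D * K * (1 - θ)⁻¹ + D * K) * D ^ β, by finiteness, ?_⟩
  filter_upwards [h.ae_tendsto_setLAverage hb] with z hz x r hr hzx
  set ρ : ℕ → ℝ := fun j => (1 / 2) ^ j * (2 * r)
  have hρ0 : ∀ j, 0 < ρ j := fun j => by positivity
  have hρs : ∀ j, ρ j = 2 * ρ (j + 1) := fun j => by simp only [ρ, pow_succ]; ring
  have hρlim : Tendsto ρ atTop (𝓝 0) := by
    have := (tendsto_pow_atTop_nhds_zero_of_lt_one (r := (1 / 2 : ℝ)) (by norm_num)
      (by norm_num)).mul_const (2 * r)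
    rwa [zero_mul] at this
  set a : ℕ → ℝ := fun j => ⨍ v in ball z (ρ j), b v ∂μ
  have hlim : Tendsto a atTop (𝓝 (b z)) := by
    rw [tendsto_iff_edist_tendsto_0]
    refine tendsto_of_tendsto_of_tendsto_of_le_of_le tendsto_const_nhds
      (hz.comp (tendsto_nhdsWithin_iff.2 ⟨hρlim, Eventually.of_forall hρ0⟩)) (fun _ => zero_le)
      fun j => ?_
    rw [edist_eq_enorm_sub]
    exact enorm_setAverage_sub_le (hb _ _) (h.measure_ball_ne_zero _ (hρ0 j))
      (h.measure_ball_ne_top _ _) _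
  have hvol : ∀ j, μ (ball z (ρ j)) ^ β = θ ^ j * μ (ball z (2 * r)) ^ β := fun j => by
    rw [h.measure_ball_mul z z (by positivity) (by positivity),
      ENNReal.mul_rpow_of_nonneg _ _ hβ.le]
    congr 1
    rw [← ENNReal.rpow_natCast, ← ENNReal.rpow_mul, mul_comm, ENNReal.rpow_mul,
      ENNReal.rpow_natCast, ← ENNReal.ofReal_pow (by positivity), ← Real.rpow_natCast,
      ← Real.rpow_natCast, ← Real.rpow_mul (by norm_num), ← Real.rpow_mul (by norm_num), mul_comm Q]
  have hstep : ∀ j, edist (a j) (a j.succ) ≤ D * K * μ (ball z (2 * r)) ^ β * θ ^ j := fun j => by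
    rw [edist_comm, edist_eq_enorm_sub]
    calc ‖a (j + 1) - a j‖ₑ ≤ ⨍⁻ w in ball z (ρ (j + 1)), ‖b w - a j‖ₑ ∂μ :=
          enorm_setAverage_sub_le (hb _ _) (h.measure_ball_ne_zero _ (hρ0 _))
            (h.measure_ball_ne_top _ _) _
      _ ≤ D * ⨍⁻ w in ball z (2 * ρ (j + 1)), ‖b w - a j‖ₑ ∂μ :=
          h.setLAverage_ball_le _ two_pos (hρ0 _) (ball_subset_ball (by linarith [hρ0 (j + 1)]))
      _ ≤ D * (K * (θ ^ j * μ (ball z (2 * r)) ^ β)) := by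
          rw [← hρs, ← hvol]
          exact mul_le_mul_right (hosc z (ρ j) (hρ0 j)) _
      _ = _ := by ring
  have h1 : ‖b z - a 0‖ₑ ≤ D * K * μ (ball z (2 * r)) ^ β * (1 - θ)⁻¹ := by
    have := edist_le_tsum_of_edist_le_of_tendsto₀ _ hstep hlim
    rwa [ENNReal.tsum_mul_left, ENNReal.tsum_geometric, edist_comm, edist_eq_enorm_sub] at this
  have e0 : ρ 0 = 2 * r := by simp [ρ]
  have h2 : ‖⨍ v in ball x r, b v ∂μ - a 0‖ₑ ≤ D * (K * μ (ball z (2 * r)) ^ β) := by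
    refine (enorm_setAverage_sub_le (hb _ _) (h.measure_ball_ne_zero _ hr)
      (h.measure_ball_ne_top _ _) _).trans ((h.setLAverage_ball_le _ two_pos hr
        (y := z) (ball_subset_ball' ?_)).trans ?_)
    · rw [mem_ball, dist_comm] at hzx; linarith
    · have := hosc z (ρ 0) (hρ0 0)
      rw [e0] at this
      simp only [a, e0]
      exact mul_le_mul_right this _
  refine (enorm_sub_le_enorm_sub_add _ (a 0) _).trans ?_
  rw [enorm_sub_rev (a 0)]
  refine (add_le_add h1 h2).trans_eq ?_
  rw [h.measure_ball_mul z x two_pos hr, ENNReal.mul_rpow_of_nonneg _ _ hβ.le]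
  ring

/-- The maximal commutator with a Campanato function of order `β > 0` is bounded from `L^r` to
`L^q` if `1 / r - 1 / q = β`. -/
lemma maximalCommutatorBounded_of_campanato {r q : ℝ} (hr : 1 < r) (hq : 1 < q)
    (hrq : 1 / r - 1 / q = β) : MaximalCommutatorBounded μ b r q := by
  have hr0 : 0 < r := by linarith
  have hq0 : 0 < q := by linarith
  obtain ⟨C₁, hC₁, hH⟩ := h.ae_enorm_sub_setAverage_le hb hK hβ hosc
  obtain ⟨C₂, hC₂, hM⟩ := h.lintegral_ballMaximal_rpow_le hr
  refine ⟨2 * C₁ * C₂ ^ (1 / q) + 1, by finiteness, fun f hf => ?_⟩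
  have hconj := (Real.HolderConjugate.conjExponent hr).symm
  set N := (∫⁻ z, f z ^ r ∂μ) ^ (1 / r) with hN
  have hNr : N ^ r = ∫⁻ z, f z ^ r ∂μ := by
    rw [hN, ← ENNReal.rpow_mul, one_div_mul_cancel hr0.ne', ENNReal.rpow_one]
  have hpt : ∀ᵐ z ∂μ, maximalCommutator μ b f z ≤
      2 * C₁ * (ballMaximal μ f z ^ (r / q) * N ^ (r * β)) := by
    filter_upwards [hH] with z hz
    refine iSup₂_le fun x s => iSup₂_le fun hs hzx => ?_
    set V := μ (ball x s)
    have hV0 : V ≠ 0 := h.measure_ball_ne_zero _ hs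
    have hVt : V ≠ ∞ := h.measure_ball_ne_top _ _
    set a := ⨍⁻ w in ball x s, f w ∂μ
    have h1 : ⨍⁻ w in ball x s, ‖b z - b w‖ₑ * f w ∂μ ≤ 2 * C₁ * (V ^ β * a) := by
      calc _ ≤ ⨍⁻ w in ball x s, (2 * C₁ * V ^ β) * f w ∂μ := by
            refine setLAverage_mono_on measurableSet_ball ?_
            filter_upwards [hH] with w hw hwx
            gcongr
            refine (enorm_sub_le_enorm_sub_add _ (⨍ v in ball x s, b v ∂μ) _).trans ?_
            rw [enorm_sub_rev (⨍ v in ball x s, b v ∂μ)]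
            refine (add_le_add (hz x s hs hzx) (hw x s hs hwx)).trans_eq ?_
            ring
        _ = _ := by
            rw [setLAverage_const_mul (by finiteness)]; ring
    have h2 : a ≤ V ^ (-(1 / r)) * N := by
      have := setLAverage_mul_le_Lp_mul_Lq hconj (μ := μ) (s := ball x s) (f := fun _ => 1)
        (g := f) aemeasurable_const hf.restrict
      simp only [one_mul, ENNReal.one_rpow] at this
      rw [setLAverage_const hV0 hVt, ENNReal.one_rpow, one_mul] at this
      refine this.trans ?_
      rw [setLAverage_eq]
      rw [ENNReal.div_rpow_of_nonneg _ _ (by positivity), ENNReal.rpow_neg, mul_comm, hN,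
        div_eq_mul_inv]
      gcongr
      exact Measure.restrict_le_self
    have hexp : (1 : ℝ) = r / q + r * β := by
      rw [← hrq]; field_simp; ring
    -- Hedberg's trick: the exponents `r / q` and `r * β` add up to `1`. Estimating only the factor
    -- `a ^ (r * β)` by Hölder produces `V ^ (-β)`, which cancels `V ^ β`.
    have h3 : V ^ β * a ≤ a ^ (r / q) * N ^ (r * β) := by
      calc V ^ β * a = V ^ β * (a ^ (r / q) * a ^ (r * β)) := by
            rw [← ENNReal.rpow_add_of_nonneg _ _ (by positivity) (by positivity), ← hexp,
              ENNReal.rpow_one]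
        _ ≤ V ^ β * (a ^ (r / q) * (V ^ (-(1 / r)) * N) ^ (r * β)) := by gcongr
        _ = (V ^ β * V ^ (-β)) * (a ^ (r / q) * N ^ (r * β)) := by
            rw [ENNReal.mul_rpow_of_nonneg _ _ (by positivity), ← ENNReal.rpow_mul,
              show -(1 / r) * (r * β) = -β by field_simp]
            ring
        _ = _ := by
            rw [← ENNReal.rpow_add _ _ hV0 hVt, add_neg_cancel, ENNReal.rpow_zero, one_mul]
    refine h1.trans (mul_le_mul_right (h3.trans ?_) _)
    gcongr
    exact le_ballMaximal μ f hs hzx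
  rcases eq_or_ne N ∞ with hNt | hNt
  · rw [hNt, ENNReal.mul_top (by simp)]
    exact le_top
  calc (∫⁻ z, maximalCommutator μ b f z ^ q ∂μ) ^ (1 / q)
      ≤ (∫⁻ z, (2 * C₁) ^ q * N ^ (r * β * q) * ballMaximal μ f z ^ r ∂μ) ^ (1 / q) := by
        gcongr ?_ ^ _
        refine lintegral_mono_ae ?_
        filter_upwards [hpt] with z hz
        refine (ENNReal.rpow_le_rpow hz hq0.le).trans_eq ?_
        rw [ENNReal.mul_rpow_of_nonneg _ _ hq0.le,
          ENNReal.mul_rpow_of_nonneg (_ ^ (r / q)) _ hq0.le, ← ENNReal.rpow_mul (ballMaximal μ f z), ← ENNReal.rpow_mul N, div_mul_cancel₀ _ hq0.ne']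
        ring
    _ ≤ ((2 * C₁) ^ q * N ^ (r * β * q) * (C₂ * N ^ r)) ^ (1 / q) := by
        rw [lintegral_const_mul' _ _ (by finiteness), hNr]
        gcongr
        exact hM f hf
    _ = 2 * C₁ * C₂ ^ (1 / q) * (N ^ (r * β) * N ^ (r / q)) := by
        simp only [ENNReal.mul_rpow_of_nonneg _ _ (one_div_nonneg.2 hq0.le), ← ENNReal.rpow_mul,
          mul_one_div_cancel hq0.ne', ENNReal.rpow_one, mul_one_div, mul_div_cancel_right₀ _ hq0.ne']
        ring
    _ ≤ _ := by
        rw [← ENNReal.rpow_add_of_nonneg _ _ (by positivity) (by positivity), ← hrq,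
          show r * (1 / r - 1 / q) + r / q = 1 by field_simp; ring, ENNReal.rpow_one]
        gcongr
        exact le_self_add

end Campanato

end HasBallVolume

end Homogeneous

/-! ### Maximal operators with lag and their commutators. -/

section Lag

variable {X ι : Type*} [MetricSpace X] [MeasurableSpace X]

/-- The maximal operator which at points of `E i` averages over `F i`. -/
def lagMaximal (μ : Measure X) (E F : ι → Set X) (f : X → ℝ≥0∞) (z : X) : ℝ≥0∞ :=
  ⨆ (i : ι) (_ : z ∈ E i), ⨍⁻ w in F i, f w ∂μ

omit [MetricSpace X] in
lemma le_lagMaximal (μ : Measure X) (E F : ι → Set X) (f : X → ℝ≥0∞) {z : X} {i : ι}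
    (hz : z ∈ E i) : ⨍⁻ w in F i, f w ∂μ ≤ lagMaximal μ E F f z :=
  le_iSup₂_of_le i hz le_rfl

/-- The open sets `E i` and the sets `F i` lie in a common ball, a fixed fraction of which is
filled by `F i`. -/
structure IsLagFamily (μ : Measure X) (κ : ℝ≥0∞) (E F : ι → Set X) : Prop where
  isOpen : ∀ i, IsOpen (E i)
  exists_ball : ∀ i, ∃ x r, 0 < r ∧ E i ⊆ ball x r ∧ F i ⊆ ball x r ∧ μ (ball x r) ≤ κ * μ (F i)

namespace IsLagFamily

variable {μ : Measure X} {κ : ℝ≥0∞} {E F : ι → Set X} (hEF : IsLagFamily μ κ E F)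
include hEF

lemma measurable_lagMaximal [OpensMeasurableSpace X] (f : X → ℝ≥0∞) :
    Measurable (lagMaximal μ E F f) :=
  LowerSemicontinuous.measurable <| lowerSemicontinuous_iSup fun i =>
    lowerSemicontinuous_iSup_mem (hEF.isOpen i) _

variable {c Q : ℝ} (h : HasBallVolume μ c Q)
include h

lemma exists_setLAverage_le {i : ι} {z : X} (hz : z ∈ E i) :
    ∃ x r, 0 < r ∧ z ∈ ball x r ∧
      ∀ f : X → ℝ≥0∞, ⨍⁻ w in F i, f w ∂μ ≤ κ * ⨍⁻ w in ball x r, f w ∂μ := by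
  obtain ⟨x, r, hr, hE, hF, hμ⟩ := hEF.exists_ball i
  refine ⟨x, r, hr, hE hz, fun f => setLAverage_le_mul_of_subset f hF hμ (fun h0 => ?_)
    (h.measure_ball_ne_top x r)⟩
  rw [h0, mul_zero, le_zero_iff] at hμ
  exact h.measure_ball_ne_zero x hr hμ

lemma lagMaximal_le_ballMaximal (f : X → ℝ≥0∞) (z : X) :
    lagMaximal μ E F f z ≤ κ * ballMaximal μ f z := by
  refine iSup₂_le fun i hz => ?_
  obtain ⟨x, r, hr, hzx, hle⟩ := hEF.exists_setLAverage_le h hz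
  exact (hle f).trans (mul_le_mul_right (le_ballMaximal μ f hr hzx) _)

/-- The triangle inequality `|b w| ≤ |b z| + |b z - b w|` under the average. With
`mul_lagMaximal_le` it says that `|b| T f` and `T (b f)` differ by at most `κ` times the maximal
commutator; two inequalities are used because values may be infinite. -/
lemma lagMaximal_mul_le {b f : X → ℝ} (hf : AEMeasurable f μ) (z : X) :
    lagMaximal μ E F (fun w => ‖b w * f w‖ₑ) z ≤
      ‖b z‖ₑ * lagMaximal μ E F (fun w => ‖f w‖ₑ) z +
        κ * maximalCommutator μ b (fun w => ‖f w‖ₑ) z := by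
  refine iSup₂_le fun i hz => ?_
  obtain ⟨x, r, hr, hzx, hle⟩ := hEF.exists_setLAverage_le h hz
  calc ⨍⁻ w in F i, ‖b w * f w‖ₑ ∂μ
      ≤ ⨍⁻ w in F i, (‖b z‖ₑ * ‖f w‖ₑ + ‖b z - b w‖ₑ * ‖f w‖ₑ) ∂μ := by
        refine setLAverage_mono (ae_of_all _ fun w => ?_)
        rw [enorm_mul, ← add_mul]
        gcongr
        have := enorm_sub_le_enorm_sub_add (b w) (b z) 0
        rwa [sub_zero, sub_zero, enorm_sub_rev, add_comm] at this
    _ = ‖b z‖ₑ * ⨍⁻ w in F i, ‖f w‖ₑ ∂μ + ⨍⁻ w in F i, ‖b z - b w‖ₑ * ‖f w‖ₑ ∂μ := by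
        rw [setLAverage_add_left (hf.enorm.const_mul _).restrict, setLAverage_const_mul enorm_ne_top]
    _ ≤ _ := by
        gcongr
        · exact le_lagMaximal μ E F (fun w => ‖f w‖ₑ) hz
        · exact (hle _).trans (mul_le_mul_right (le_maximalCommutator μ b _ hr hzx) _)

lemma mul_lagMaximal_le {b f : X → ℝ} (hb : AEMeasurable b μ) (hf : AEMeasurable f μ) (z : X) :
    ‖b z‖ₑ * lagMaximal μ E F (fun w => ‖f w‖ₑ) z ≤
      lagMaximal μ E F (fun w => ‖b w * f w‖ₑ) z +
        κ * maximalCommutator μ b (fun w => ‖f w‖ₑ) z := by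
  simp only [lagMaximal, ENNReal.mul_iSup]
  refine iSup₂_le fun i hz => ?_
  obtain ⟨x, r, hr, hzx, hle⟩ := hEF.exists_setLAverage_le h hz
  calc ‖b z‖ₑ * ⨍⁻ w in F i, ‖f w‖ₑ ∂μ
      ≤ ⨍⁻ w in F i, (‖b w * f w‖ₑ + ‖b z - b w‖ₑ * ‖f w‖ₑ) ∂μ := by
        rw [← setLAverage_const_mul enorm_ne_top]
        refine setLAverage_mono (ae_of_all _ fun w => ?_)
        rw [enorm_mul, ← add_mul]
        gcongr
        have := enorm_sub_le_enorm_sub_add (b z) (b w) 0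
        rwa [sub_zero, sub_zero, add_comm] at this
    _ = ⨍⁻ w in F i, ‖b w * f w‖ₑ ∂μ + ⨍⁻ w in F i, ‖b z - b w‖ₑ * ‖f w‖ₑ ∂μ :=
        setLAverage_add_left (hb.mul hf).enorm.restrict _
    _ ≤ _ := by
        gcongr
        · exact le_lagMaximal μ E F (fun w => ‖b w * f w‖ₑ) hz
        · exact (hle _).trans (mul_le_mul_right (le_maximalCommutator μ b _ hr hzx) _)

/-- From `b = |b| - 2 b₋` one gets `[b,T] f = (|b| T f - T (b f)) - 2 b₋ T f`. If the maximal
commutator is infinite at `z` nothing is claimed; otherwise `T (b f)` is finite there as well. -/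
lemma enorm_commutator_le {b f : X → ℝ} (hb : AEMeasurable b μ) (hf : AEMeasurable f μ)
    (hκ0 : κ ≠ 0) (hκ : κ ≠ ∞) {z : X} (hz : lagMaximal μ E F (fun w => ‖f w‖ₑ) z < ∞) :
    ‖b z * (lagMaximal μ E F (fun w => ‖f w‖ₑ) z).toReal -
        (lagMaximal μ E F (fun w => ‖b w * f w‖ₑ) z).toReal‖ₑ ≤
      κ * maximalCommutator μ b (fun w => ‖f w‖ₑ) z +
        2 * (‖max (-b z) 0‖ₑ * lagMaximal μ E F (fun w => ‖f w‖ₑ) z) := by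
  have h1 := hEF.lagMaximal_mul_le h (b := b) hf z
  have h2 := hEF.mul_lagMaximal_le h hb hf z
  rcases eq_or_ne (maximalCommutator μ b (fun w => ‖f w‖ₑ) z) ∞ with hD | hD
  · rw [hD, ENNReal.mul_top hκ0, top_add]; exact le_top
  have hD' := ENNReal.mul_ne_top hκ hD
  have hB : lagMaximal μ E F (fun w => ‖b w * f w‖ₑ) z ≠ ∞ := by
    refine ne_top_of_le_ne_top ?_ h1
    finiteness
  lift lagMaximal μ E F (fun w => ‖f w‖ₑ) z to ℝ≥0 using hz.ne with A hA
  lift lagMaximal μ E F (fun w => ‖b w * f w‖ₑ) z to ℝ≥0 using hB with B hB'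
  lift κ * maximalCommutator μ b (fun w => ‖f w‖ₑ) z to ℝ≥0 using hD' with D hD''
  simp only [enorm_eq_nnnorm] at h1 h2 ⊢
  norm_cast at h1 h2 ⊢
  rw [← NNReal.coe_le_coe] at h1 h2 ⊢
  push_cast at h1 h2 ⊢
  simp only [Real.norm_eq_abs, ENNReal.coe_toReal] at h1 h2 ⊢
  have hA0 : (0 : ℝ) ≤ A := A.2
  rw [abs_of_nonneg (le_max_right (-b z) 0)]
  rcases le_total 0 (b z) with hbz | hbz
  · rw [abs_of_nonneg hbz] at h1 h2
    rw [max_eq_right (by linarith), abs_le]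
    constructor <;> linarith
  · have := mul_nonpos_of_nonpos_of_nonneg hbz hA0
    rw [abs_of_nonpos hbz] at h1 h2
    rw [max_eq_left (by linarith), abs_le]
    constructor <;> linarith

variable [BorelSpace X] [SecondCountableTopology X]

/-- If the maximal commutator is bounded from `L^r` to `L^q` and multiplication with the negative
part of `b` causes no loss, then the commutators with maximal operators with lag are bounded. -/
lemma commutator_bounded {b : X → ℝ} (hb : AEMeasurable b μ) (hκ0 : κ ≠ 0) (hκ : κ ≠ ∞) {r q : ℝ}
    (hr : 1 < r) (hq : 1 < q) (hcomm : MaximalCommutatorBounded μ b r q) {N : ℝ≥0∞} (hN : N ≠ ∞)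
    (hbN : ∀ᵐ z ∂μ, ‖max (-b z) 0‖ₑ ≤ N) (hN0 : r = q ∨ N = 0) :
    ∃ C : ℝ≥0, ∀ f : X → ℝ, MemLp f (ENNReal.ofReal r) μ →
      (∀ᵐ z ∂μ, lagMaximal μ E F (fun w => ‖f w‖ₑ) z < ∞) ∧
      (∀ᵐ z ∂μ, lagMaximal μ E F (fun w => ‖b w * f w‖ₑ) z < ∞) ∧
      MemLp (fun z => b z * (lagMaximal μ E F (fun w => ‖f w‖ₑ) z).toReal -
        (lagMaximal μ E F (fun w => ‖b w * f w‖ₑ) z).toReal) (ENNReal.ofReal q) μ ∧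
      eLpNorm (fun z => b z * (lagMaximal μ E F (fun w => ‖f w‖ₑ) z).toReal -
        (lagMaximal μ E F (fun w => ‖b w * f w‖ₑ) z).toReal) (ENNReal.ofReal q) μ ≤
        C * eLpNorm f (ENNReal.ofReal r) μ := by
  have hr0 : 0 < r := by linarith
  have hq0 : 0 < q := by linarith
  obtain ⟨C₁, hC₁, hC⟩ := hcomm
  obtain ⟨C₂, hC₂, hM⟩ := h.lintegral_ballMaximal_rpow_le hr
  have hNM : ∀ f : X → ℝ≥0∞, AEMeasurable f μ →
      (∫⁻ z, (N * lagMaximal μ E F f z) ^ q ∂μ) ^ (1 / q) ≤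
        N * κ * C₂ ^ (1 / r) * (∫⁻ z, f z ^ r ∂μ) ^ (1 / r) := fun f hf => by
    rcases hN0 with rfl | rfl
    · calc _ ≤ (∫⁻ z, (N * κ) ^ r * ballMaximal μ f z ^ r ∂μ) ^ (1 / r) := by
            gcongr ?_ ^ _
            refine lintegral_mono fun z => ?_
            rw [← ENNReal.mul_rpow_of_nonneg _ _ hr0.le, mul_assoc]
            gcongr
            exact hEF.lagMaximal_le_ballMaximal h f z
        _ ≤ ((N * κ) ^ r * (C₂ * ∫⁻ z, f z ^ r ∂μ)) ^ (1 / r) := by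
            rw [lintegral_const_mul' _ _ (by finiteness)]
            gcongr
            exact hM f hf
        _ = _ := by
            rw [ENNReal.mul_rpow_of_nonneg _ _ (by positivity),
              ENNReal.mul_rpow_of_nonneg C₂ _ (by positivity), ← ENNReal.rpow_mul,
              mul_one_div_cancel hr0.ne', ENNReal.rpow_one]
            ring
    · simp [hq0]
  have hCC : 2 ^ ((q - 1) * (1 / q)) * (κ * C₁ + 2 * (N * κ * C₂ ^ (1 / r))) ≠ ∞ := by
    have : 0 ≤ q - 1 := by linarith
    finiteness
  refine ⟨(2 ^ ((q - 1) * (1 / q)) * (κ * C₁ + 2 * (N * κ * C₂ ^ (1 / r)))).toNNReal,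
    fun f hfr => ?_⟩
  rw [ENNReal.coe_toNNReal hCC]
  have hfm : AEMeasurable f μ := hfr.1.aemeasurable
  have hfn : eLpNorm f (ENNReal.ofReal r) μ = (∫⁻ z, ‖f z‖ₑ ^ r ∂μ) ^ (1 / r) := by
    rw [eLpNorm_eq_lintegral_rpow_enorm_toReal (by simpa using hr0) (by simp),
      ENNReal.toReal_ofReal hr0.le]
  have hfin : ∫⁻ z, ‖f z‖ₑ ^ r ∂μ ≠ ∞ := by
    have := hfr.2.ne
    rw [hfn] at this
    intro hcon
    rw [hcon, ENNReal.top_rpow_of_pos (by positivity)] at this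
    exact this rfl
  set T := lagMaximal μ E F (fun w => ‖f w‖ₑ)
  set Tb := lagMaximal μ E F (fun w => ‖b w * f w‖ₑ)
  have hTm : Measurable T := hEF.measurable_lagMaximal _
  have hTbm : Measurable Tb := hEF.measurable_lagMaximal _
  have hT : ∀ᵐ z ∂μ, T z < ∞ := by
    have h1 : ∫⁻ z, ballMaximal μ (fun w => ‖f w‖ₑ) z ^ r ∂μ ≠ ∞ :=
      ne_top_of_le_ne_top (by finiteness) (hM _ hfm.enorm)
    filter_upwards [ae_lt_top ((measurable_ballMaximal μ _).pow_const r) h1] with z hz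
    refine (hEF.lagMaximal_le_ballMaximal h _ z).trans_lt (ENNReal.mul_lt_top hκ.lt_top ?_)
    exact (ENNReal.rpow_lt_top_iff_of_pos hr0).1 hz
  have hcf := hC _ hfm.enorm
  have hTb : ∀ᵐ z ∂μ, Tb z < ∞ := by
    -- Measurability of the maximal commutator is not established, so its integral is compared with
    -- that of a measurable function equal to `∞` where `Tb` is infinite.
    have h1 : ∫⁻ z, ({z | Tb z = ∞}.indicator (fun _ => ∞) z : ℝ≥0∞) ∂μ ≠ ∞ := by
      refine ne_top_of_le_ne_top (b := ∫⁻ z, maximalCommutator μ b (fun w => ‖f w‖ₑ) z ^ q ∂μ) ?_ ?_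
      · have h2 := ne_top_of_le_ne_top (by finiteness) hcf
        intro hcon
        rw [hcon, ENNReal.top_rpow_of_pos (by positivity)] at h2
        exact h2 rfl
      · refine lintegral_mono_ae ?_
        filter_upwards [hT] with z hz
        by_cases hzb : Tb z = ∞
        · have h3 := hEF.lagMaximal_mul_le h (b := b) hfm z
          have h4 : maximalCommutator μ b (fun w => ‖f w‖ₑ) z = ∞ := by
            by_contra hcon
            have : ‖b z‖ₑ * T z + κ * maximalCommutator μ b (fun w => ‖f w‖ₑ) z ≠ ∞ := by
              finiteness
            exact this (top_unique (hzb ▸ h3))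
          rw [h4, ENNReal.top_rpow_of_pos hq0]
          exact le_top
        · rw [indicator_of_notMem (s := {z | Tb z = ∞}) hzb]
          exact zero_le
    filter_upwards [ae_lt_top (measurable_const.indicator (hTbm (measurableSet_singleton _))) h1]
      with z hz
    by_contra hcon
    rw [indicator_of_mem (by simpa using hcon)] at hz
    exact lt_irrefl _ hz
  have hnorm : eLpNorm (fun z => b z * (T z).toReal - (Tb z).toReal) (ENNReal.ofReal q) μ ≤
      2 ^ ((q - 1) * (1 / q)) * (κ * C₁ + 2 * (N * κ * C₂ ^ (1 / r))) *
        eLpNorm f (ENNReal.ofReal r) μ := by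
    rw [hfn, eLpNorm_eq_lintegral_rpow_enorm_toReal (by simpa using hq0) (by simp),
      ENNReal.toReal_ofReal hq0.le]
    have hq1 : 0 ≤ 1 / q := by positivity
    calc _ ≤ (∫⁻ z, 2 ^ (q - 1) * (κ ^ q * maximalCommutator μ b (fun w => ‖f w‖ₑ) z ^ q +
            2 ^ q * (N * T z) ^ q) ∂μ) ^ (1 / q) := by
          gcongr ?_ ^ _
          refine lintegral_mono_ae ?_
          filter_upwards [hT, hbN] with z hz hzN
          have h5 := hEF.enorm_commutator_le h hb hfm hκ0 hκ hz
          refine (ENNReal.rpow_le_rpow (h5.trans ?_) hq0.le).trans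
            ((ENNReal.rpow_add_le_mul_rpow_add_rpow
              (κ * maximalCommutator μ b (fun w => ‖f w‖ₑ) z) (2 * (N * T z)) hq.le).trans_eq ?_)
          · gcongr
          · rw [ENNReal.mul_rpow_of_nonneg _ _ hq0.le,
              ENNReal.mul_rpow_of_nonneg 2 (N * T z) hq0.le]
      _ = (2 ^ (q - 1) * (κ ^ q * ∫⁻ z, maximalCommutator μ b (fun w => ‖f w‖ₑ) z ^ q ∂μ +
            2 ^ q * ∫⁻ z, (N * T z) ^ q ∂μ)) ^ (1 / q) := by
          rw [lintegral_const_mul' _ _ (by finiteness), lintegral_add_right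
            _ (((hTm.const_mul N).pow_const q).const_mul _),
            lintegral_const_mul' _ _ (by finiteness), lintegral_const_mul' _ _ (by finiteness)]
      _ ≤ 2 ^ ((q - 1) * (1 / q)) *
            (κ * (∫⁻ z, maximalCommutator μ b (fun w => ‖f w‖ₑ) z ^ q ∂μ) ^ (1 / q) +
              2 * (∫⁻ z, (N * T z) ^ q ∂μ) ^ (1 / q)) := by
          rw [ENNReal.mul_rpow_of_nonneg _ _ hq1, ← ENNReal.rpow_mul]
          gcongr
          refine (ENNReal.rpow_add_le_add_rpow _ _ hq1 ?_).trans_eq ?_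
          · rw [div_le_one hq0]; exact hq.le
          · simp only [ENNReal.mul_rpow_of_nonneg _ _ hq1, ← ENNReal.rpow_mul,
              mul_one_div_cancel hq0.ne', ENNReal.rpow_one]
      _ ≤ 2 ^ ((q - 1) * (1 / q)) * (κ * (C₁ * (∫⁻ z, ‖f z‖ₑ ^ r ∂μ) ^ (1 / r)) +
            2 * (N * κ * C₂ ^ (1 / r) * (∫⁻ z, ‖f z‖ₑ ^ r ∂μ) ^ (1 / r))) := by
          gcongr
          exact hNM _ hfm.enorm
      _ = _ := by ring
  refine ⟨hT, hTb, ⟨?_, hnorm.trans_lt (ENNReal.mul_lt_top hCC.lt_top hfr.2)⟩, hnorm⟩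
  exact ((hb.mul hTm.ennreal_toReal.aemeasurable).sub
    hTbm.ennreal_toReal.aemeasurable).aestronglyMeasurable

end IsLagFamily

end Lag

/-! ### The parabolic metric -/

/-- Space-time, equipped with the parabolic metric `max |x - y| |t - s| ^ (1 / p)`. -/
def ParabolicSpace (n : ℕ) (_p : ℝ) : Type := SpaceTime n

section Metric

variable {n : ℕ} {p : ℝ}

instance : MeasureSpace (ParabolicSpace n p) := inferInstanceAs (MeasureSpace (SpaceTime n))

lemma inv_pos_of_one_lt (hp : 1 < p) : 0 < p⁻¹ := by positivity

lemma inv_le_one_of_one_lt (hp : 1 < p) : p⁻¹ ≤ 1 := inv_le_one_of_one_le₀ hp.le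

/-- Space-time is homeomorphic to the product of space with snowflaked time. -/
def snowflakeHomeomorph (n : ℕ) (hp : 1 < p) : SpaceTime n ≃ₜ
    (Fin n → ℝ) × Metric.Snowflaking ℝ p⁻¹ (inv_pos_of_one_lt hp) (inv_le_one_of_one_lt hp) :=
  (Homeomorph.refl _).prodCongr Metric.Snowflaking.homeomorph.symm

/-- The topology is replaced by the product topology of `SpaceTime n`, so that the Borel and
countability structure and all integrals are literally shared by the two types. -/
instance [hp : Fact (1 < p)] : MetricSpace (ParabolicSpace n p) :=
  (MetricSpace.induced (snowflakeHomeomorph n hp.out) (snowflakeHomeomorph n hp.out).injective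
    inferInstance).replaceTopology (U := inferInstanceAs (TopologicalSpace (SpaceTime n)))
    (snowflakeHomeomorph n hp.out).isInducing.eq_induced

variable [hp : Fact (1 < p)]

instance : BorelSpace (ParabolicSpace n p) := inferInstanceAs (BorelSpace (SpaceTime n))

instance : SecondCountableTopology (ParabolicSpace n p) :=
  inferInstanceAs (SecondCountableTopology (SpaceTime n))

lemma parabolicSpace_dist (z w : ParabolicSpace n p) :
    dist z w = max (dist z.1 w.1) (dist z.2 w.2 ^ p⁻¹) := rfl

omit hp in
lemma mem_rect_iff {z w : SpaceTime n} {r : ℝ} :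
    w ∈ rect p z.1 z.2 r ↔ dist w.1 z.1 < r ∧ dist w.2 z.2 < r ^ p := by
  rw [rect, mem_prod, cube, mem_ball, ← Real.ball_eq_Ioo, mem_ball]

/-- The reason for the metric: `|t - s| ^ (1 / p) < r` means `|t - s| < r ^ p`. -/
lemma parabolicSpace_ball (z : ParabolicSpace n p) {r : ℝ} (hr : 0 < r) :
    ball z r = rect p z.1 z.2 r := by
  have hp0 : 0 < p := one_pos.trans hp.out
  refine Set.ext fun w => Iff.trans ?_ (mem_rect_iff (z := z) (w := w) (r := r)).symm
  rw [mem_ball, parabolicSpace_dist, max_lt_iff,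
    Real.rpow_inv_lt_iff_of_pos dist_nonneg hr.le hp0]

omit hp in
lemma volume_cube_prod_Ioo (x : Fin n → ℝ) {L : ℝ} (hL : 0 < L) (a b : ℝ) :
    volume (cube x L ×ˢ Ioo a b : Set (SpaceTime n)) =
      ENNReal.ofReal ((2 * L) ^ n * (b - a)) := by
  rw [Measure.volume_eq_prod, Measure.prod_prod, cube, Real.volume_pi_ball _ hL, Real.volume_Ioo,
    Fintype.card_fin, ENNReal.ofReal_mul (by positivity)]

omit hp in
lemma volume_rect (x : Fin n → ℝ) (t : ℝ) {L : ℝ} (hL : 0 < L) :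
    volume (rect p x t L) = ENNReal.ofReal (2 ^ (n + 1) * L ^ ((n : ℝ) + p)) := by
  rw [rect, volume_cube_prod_Ioo x hL, Real.rpow_add hL, Real.rpow_natCast, mul_pow]
  congr 1; ring

lemma hasBallVolume_parabolicSpace : HasBallVolume (volume : Measure (ParabolicSpace n p))
    (2 ^ (n + 1)) ((n : ℝ) + p) where
  c_pos := by positivity
  Q_pos := by have := hp.out; positivity
  measure_ball z r hr := by
    rw [parabolicSpace_ball z hr]
    exact volume_rect z.1 z.2 hr

omit hp in
lemma integrableOn_cube_prod_Ioo {b : SpaceTime n → ℝ} (hb : LocallyIntegrable b)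
    (x : Fin n → ℝ) (L s t : ℝ) : IntegrableOn b (cube x L ×ˢ Ioo s t) :=
  (hb.integrableOn_isCompact ((isCompact_closedBall x L).prod isCompact_Icc)).mono_set
    (prod_mono ball_subset_closedBall Ioo_subset_Icc_self)

lemma integrableOn_parabolicSpace_ball {b : SpaceTime n → ℝ} (hb : LocallyIntegrable b)
    (z : ParabolicSpace n p) (r : ℝ) :
    IntegrableOn (α := ParabolicSpace n p) b (ball z r) volume := by
  rcases le_or_gt r 0 with hr | hr
  · rw [ball_eq_empty.2 hr]; exact integrableOn_empty
  · rw [parabolicSpace_ball z hr]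
    exact integrableOn_cube_prod_Ioo hb _ _ _ _

end Metric

/-! ### Sufficiency -/

section Sufficiency

variable {n : ℕ} {p γ : ℝ}

/-- The parameters of parabolic rectangles. -/
abbrev RectIndex (n : ℕ) : Type := (Fin n → ℝ) × ℝ × {L : ℝ // 0 < L}

lemma maximalPlus_eq_lagMaximal (f : SpaceTime n → ℝ) :
    maximalPlus p γ f = lagMaximal volume (fun i : RectIndex n => lowerPart p γ i.1 i.2.1 i.2.2)
      (fun i => upperPart p γ i.1 i.2.1 i.2.2) fun w => ‖f w‖ₑ := by
  ext z
  simp only [maximalPlus, lagMaximal, iSup_prod, iSup_subtype]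

lemma maximalMinus_eq_lagMaximal (f : SpaceTime n → ℝ) :
    maximalMinus p γ f = lagMaximal volume (fun i : RectIndex n => upperPart p γ i.1 i.2.1 i.2.2)
      (fun i => lowerPart p γ i.1 i.2.1 i.2.2) fun w => ‖f w‖ₑ := by
  ext z
  simp only [maximalMinus, lagMaximal, iSup_prod, iSup_subtype]

lemma volume_upperPart (x : Fin n → ℝ) (t : ℝ) {L : ℝ} (hL : 0 < L) :
    volume (upperPart p γ x t L) = ENNReal.ofReal ((1 - γ) * (2 * L) ^ n * L ^ p) := by
  rw [upperPart, volume_cube_prod_Ioo x hL]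
  congr 1; ring

lemma volume_lowerPart (x : Fin n → ℝ) (t : ℝ) {L : ℝ} (hL : 0 < L) :
    volume (lowerPart p γ x t L) = ENNReal.ofReal ((1 - γ) * (2 * L) ^ n * L ^ p) := by
  rw [lowerPart, volume_cube_prod_Ioo x hL]
  congr 1; ring

lemma volume_rect_le (hγ : γ < 1) (x : Fin n → ℝ) (t : ℝ) {L : ℝ} (hL : 0 < L) :
    volume (rect p x t L) ≤
      ENNReal.ofReal (2 / (1 - γ)) * ENNReal.ofReal ((1 - γ) * (2 * L) ^ n * L ^ p) := by
  have : 0 < 1 - γ := by linarith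
  rw [rect, volume_cube_prod_Ioo x hL, ← ENNReal.ofReal_mul (by positivity)]
  refine ENNReal.ofReal_le_ofReal (le_of_eq ?_)
  field_simp
  ring

lemma upperPart_subset_rect (hγ : 0 < γ) (x : Fin n → ℝ) (t : ℝ) {L : ℝ} (hL : 0 < L) :
    upperPart p γ x t L ⊆ rect p x t L := by
  have : 0 < L ^ p := by positivity
  exact prod_mono Subset.rfl (Ioo_subset_Ioo (by nlinarith) le_rfl)

lemma lowerPart_subset_rect (hγ : 0 < γ) (x : Fin n → ℝ) (t : ℝ) {L : ℝ} (hL : 0 < L) :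
    lowerPart p γ x t L ⊆ rect p x t L := by
  have : 0 < L ^ p := by positivity
  exact prod_mono Subset.rfl (Ioo_subset_Ioo le_rfl (by nlinarith))

variable [hp : Fact (1 < p)]

lemma isLagFamily_lower_upper (hγ : γ ∈ Ioo (0 : ℝ) 1) :
    IsLagFamily (X := ParabolicSpace n p) volume (ENNReal.ofReal (2 / (1 - γ)))
      (fun i : RectIndex n => lowerPart p γ i.1 i.2.1 i.2.2)
      (fun i => upperPart p γ i.1 i.2.1 i.2.2) where
  isOpen i := (isOpen_ball.prod isOpen_Ioo : IsOpen (lowerPart p γ i.1 i.2.1 i.2.2))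
  exists_ball i := by
    have hL := i.2.2.2
    have hball := parabolicSpace_ball (n := n) (p := p) (i.1, i.2.1) hL
    exact ⟨(i.1, i.2.1), i.2.2, hL, (lowerPart_subset_rect hγ.1 _ _ hL).trans hball.ge,
      (upperPart_subset_rect hγ.1 _ _ hL).trans hball.ge, (congrArg volume hball).trans_le
      ((volume_rect_le hγ.2 _ _ hL).trans_eq (by rw [← volume_upperPart _ _ hL]; rfl))⟩

lemma isLagFamily_upper_lower (hγ : γ ∈ Ioo (0 : ℝ) 1) :
    IsLagFamily (X := ParabolicSpace n p) volume (ENNReal.ofReal (2 / (1 - γ)))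
      (fun i : RectIndex n => upperPart p γ i.1 i.2.1 i.2.2)
      (fun i => lowerPart p γ i.1 i.2.1 i.2.2) where
  isOpen i := (isOpen_ball.prod isOpen_Ioo : IsOpen (upperPart p γ i.1 i.2.1 i.2.2))
  exists_ball i := by
    have hL := i.2.2.2
    have hball := parabolicSpace_ball (n := n) (p := p) (i.1, i.2.1) hL
    exact ⟨(i.1, i.2.1), i.2.2, hL, (upperPart_subset_rect hγ.1 _ _ hL).trans hball.ge,
      (lowerPart_subset_rect hγ.1 _ _ hL).trans hball.ge, (congrArg volume hball).trans_le
      ((volume_rect_le hγ.2 _ _ hL).trans_eq (by rw [← volume_lowerPart _ _ hL]; rfl))⟩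

lemma commutatorBounded_of_maximalCommutatorBounded (hγ : γ ∈ Ioo (0 : ℝ) 1)
    {b : SpaceTime n → ℝ} (hb : LocallyIntegrable b) {r q : ℝ} (hr : 1 < r) (hq : 1 < q)
    (hcomm : MaximalCommutatorBounded (X := ParabolicSpace n p) volume b r q) {N : ℝ≥0∞}
    (hN : N ≠ ∞) (hbN : ∀ᵐ z, ‖max (-b z) 0‖ₑ ≤ N) (hN0 : r = q ∨ N = 0) :
    CommutatorBounded b (maximalPlus p γ) r q ∧ CommutatorBounded b (maximalMinus p γ) r q := by
  have hbm : AEMeasurable b := hb.aestronglyMeasurable.aemeasurable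
  have hκ : ENNReal.ofReal (2 / (1 - γ)) ≠ 0 := by
    have : 0 < 1 - γ := by linarith [hγ.2]
    rw [ne_eq, ENNReal.ofReal_eq_zero, not_le]; positivity
  constructor
  · obtain ⟨C, hC⟩ := (isLagFamily_lower_upper (n := n) (p := p) hγ).commutator_bounded
      hasBallVolume_parabolicSpace hbm hκ ENNReal.ofReal_ne_top hr hq hcomm hN hbN hN0
    refine ⟨C, fun f hf _ => ?_⟩
    unfold commutator
    simp_rw [maximalPlus_eq_lagMaximal]
    exact hC f hf
  · obtain ⟨C, hC⟩ := (isLagFamily_upper_lower (n := n) (p := p) hγ).commutator_bounded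
      hasBallVolume_parabolicSpace hbm hκ ENNReal.ofReal_ne_top hr hq hcomm hN hbN hN0
    refine ⟨C, fun f hf _ => ?_⟩
    unfold commutator
    simp_rw [maximalMinus_eq_lagMaximal]
    exact hC f hf

lemma oscillation_le_campanatoSeminorm (β : ℝ) (b : SpaceTime n → ℝ)
    (z : ParabolicSpace n p) (r : ℝ) (hr : 0 < r) :
    ⨍⁻ w in ball z r, ‖b w - ⨍ v in ball z r, b v‖ₑ ∂volume ≤
      campanatoSeminorm p β b * volume (ball z r) ^ β := by
  have h0 := hasBallVolume_parabolicSpace.measure_ball_ne_zero z hr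
  have h1 := hasBallVolume_parabolicSpace.measure_ball_ne_top z r
  have h2 : volume (ball z r) ^ (-β) * ⨍⁻ w in ball z r, ‖b w - ⨍ v in ball z r, b v‖ₑ ∂volume ≤
      campanatoSeminorm p β b := by
    rw [parabolicSpace_ball z hr]
    exact le_iSup₂_of_le z.1 z.2 (le_iSup₂_of_le r hr le_rfl)
  calc _ = volume (ball z r) ^ β *
        (volume (ball z r) ^ (-β) * ⨍⁻ w in ball z r, ‖b w - ⨍ v in ball z r, b v‖ₑ ∂volume) := by
        rw [← mul_assoc, ← ENNReal.rpow_add _ _ h0 h1, add_neg_cancel, ENNReal.rpow_zero, one_mul]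
    _ ≤ _ := by rw [mul_comm]; gcongr

lemma oscillation_le_campanatoSeminorm_zero (b : SpaceTime n → ℝ)
    (z : ParabolicSpace n p) (r : ℝ) (hr : 0 < r) :
    ⨍⁻ w in ball z r, ‖b w - ⨍ v in ball z r, b v‖ₑ ∂volume ≤ campanatoSeminorm p 0 b := by
  simpa using oscillation_le_campanatoSeminorm 0 b z r hr

lemma commutatorBounded_of_memPBMO (hγ : γ ∈ Ioo (0 : ℝ) 1) {b : SpaceTime n → ℝ}
    (hb : MemPBMO p b) (hbneg : MemLp (fun z => max (-b z) 0) ∞) {q : ℝ} (hq : 1 < q) :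
    CommutatorBounded b (maximalPlus p γ) q q ∧ CommutatorBounded b (maximalMinus p γ) q q := by
  refine commutatorBounded_of_maximalCommutatorBounded hγ hb.1 hq hq
    (hasBallVolume_parabolicSpace.maximalCommutatorBounded_of_oscillation_le
      (integrableOn_parabolicSpace_ball hb.1) hb.2.ne (oscillation_le_campanatoSeminorm_zero b) hq) hbneg.2.ne ?_ (.inl rfl)
  rw [eLpNorm_exponent_top]
  exact ae_le_eLpNormEssSup

lemma commutatorBounded_of_memPC (hγ : γ ∈ Ioo (0 : ℝ) 1) {b : SpaceTime n → ℝ} {β : ℝ}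
    (hβ : 0 < β) (hb : MemPC p β b) (hb0 : ∀ᵐ z, 0 ≤ b z) {r q : ℝ} (hr : 1 < r) (hq : 1 < q)
    (hrq : 1 / r - 1 / q = β) :
    CommutatorBounded b (maximalPlus p γ) r q ∧ CommutatorBounded b (maximalMinus p γ) r q := by
  refine commutatorBounded_of_maximalCommutatorBounded hγ hb.1 hr hq
    (hasBallVolume_parabolicSpace.maximalCommutatorBounded_of_campanato
      (integrableOn_parabolicSpace_ball hb.1) hb.2.ne hβ (oscillation_le_campanatoSeminorm β b) hr hq hrq)
    ENNReal.zero_ne_top ?_ (.inr rfl)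
  filter_upwards [hb0] with z hz
  simp [hz]

/-- A function all of whose local oscillations have finite moments multiplies `L^r` into the
locally integrable functions. -/
lemma locallyIntegrable_mul_of_lintegral_lt_top {b : SpaceTime n → ℝ} (hb : LocallyIntegrable b)
    (hosc : ∀ s : ℝ, 1 < s → ∀ (z : ParabolicSpace n p) (r : ℝ), 0 < r →
      ∃ m : ℝ, ∫⁻ w in ball z r, ‖b w - m‖ₑ ^ s < ∞)
    {r : ℝ} (hr : 1 < r) {f : SpaceTime n → ℝ} (hf : MemLp f (ENNReal.ofReal r)) :
    LocallyIntegrable fun z => b z * f z := by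
  have hconj := (Real.HolderConjugate.conjExponent hr).symm
  refine locallyIntegrable_of_integrableOn_ball (X := ParabolicSpace n p)
    (μ := (volume : Measure (ParabolicSpace n p))) fun z s => ?_
  rcases le_or_gt s 0 with hs | hs
  · rw [ball_eq_empty.2 hs]; exact integrableOn_empty
  obtain ⟨m, hm⟩ := hosc _ hconj.lt z s hs
  have hfin : IsFiniteMeasure ((volume : Measure (ParabolicSpace n p)).restrict (ball z s)) :=
    ⟨by simpa using (hasBallVolume_parabolicSpace.measure_ball_ne_top z s).lt_top⟩
  have h1 : MemLp (fun w : ParabolicSpace n p => b w - m) (ENNReal.ofReal r.conjExponent)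
      (volume.restrict (ball z s)) := by
    refine ⟨(hb.aestronglyMeasurable.sub aestronglyMeasurable_const).restrict, ?_⟩
    rw [eLpNorm_eq_lintegral_rpow_enorm_toReal (by simpa using hconj.pos) (by simp),
      ENNReal.toReal_ofReal hconj.nonneg]
    exact ENNReal.rpow_lt_top_of_nonneg hconj.one_div_nonneg hm.ne
  have h2 : MemLp (fun w : ParabolicSpace n p => b w) (ENNReal.ofReal r.conjExponent)
      (volume.restrict (ball z s)) := by
    refine (h1.add (memLp_const m)).ae_eq (ae_of_all _ fun w => ?_)
    exact sub_add_cancel (b w) m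
  have : (ENNReal.ofReal r.conjExponent).HolderTriple (ENNReal.ofReal r) 1 := hconj.ennrealOfReal
  exact h2.integrable_mul (hf.restrict (ball z s : Set (ParabolicSpace n p)))

lemma MemPBMO.locallyIntegrable_mul {b : SpaceTime n → ℝ} (hb : MemPBMO p b) {r : ℝ} (hr : 1 < r)
    {f : SpaceTime n → ℝ} (hf : MemLp f (ENNReal.ofReal r)) :
    LocallyIntegrable fun z => b z * f z := by
  refine locallyIntegrable_mul_of_lintegral_lt_top (p := p) hb.1 (fun s hs z r hr => ?_) hr hf
  obtain ⟨C, hC, h⟩ := hasBallVolume_parabolicSpace.lintegral_oscillation_rpow_le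
    (integrableOn_parabolicSpace_ball hb.1) hb.2.ne (oscillation_le_campanatoSeminorm_zero b) (one_pos.trans hs)
  exact ⟨_, (h z r hr).trans_lt (ENNReal.mul_lt_top hC.lt_top
    (hasBallVolume_parabolicSpace.measure_ball_ne_top z r).lt_top)⟩

lemma MemPC.locallyIntegrable_mul {b : SpaceTime n → ℝ} {β : ℝ} (hβ : 0 < β) (hb : MemPC p β b)
    {r : ℝ} (hr : 1 < r) {f : SpaceTime n → ℝ} (hf : MemLp f (ENNReal.ofReal r)) :
    LocallyIntegrable fun z => b z * f z := by
  refine locallyIntegrable_mul_of_lintegral_lt_top (p := p) hb.1 (fun s hs z r hr => ?_) hr hf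
  obtain ⟨C, hC, h⟩ := hasBallVolume_parabolicSpace.ae_enorm_sub_setAverage_le
    (integrableOn_parabolicSpace_ball hb.1) hb.2.ne hβ (oscillation_le_campanatoSeminorm β b)
  have hV := hasBallVolume_parabolicSpace.measure_ball_ne_top z r
  have hs0 : 0 ≤ s := by linarith
  refine ⟨⨍ v in ball z r, b v, lt_of_le_of_lt (b := ∫⁻ _ in ball z r, (C * volume (ball z r) ^ β) ^ s)
    (setLIntegral_mono_ae' measurableSet_ball ?_) ?_⟩
  · filter_upwards [h] with w hw hwz
    exact ENNReal.rpow_le_rpow (hw z r hr hwz) hs0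
  · rw [setLIntegral_const]
    exact ENNReal.mul_lt_top (by finiteness) hV.lt_top

end Sufficiency

/-! ### Necessity -/

/-! ### Oscillation estimates on pairs of sets. -/

section Measure

variable {X : Type*} [MeasurableSpace X] {μ : Measure X} {b : X → ℝ}

/-- Two one-sided bounds for `b` on `E` and `F` control the oscillation of `b` on `E` and its
negative part on `F`. -/
lemma oscillation_and_negPart_le {E F : Set X} {v A : ℝ} (hv : 0 < v) (hE : μ.real E = v)
    (hF : μ.real F = v) (hbE : IntegrableOn b E μ) (hbF : IntegrableOn b F μ)
    (h1 : ∫⁻ z in E, ENNReal.ofReal (⨍ w in F, |b w| ∂μ - b z) ∂μ ≤ ENNReal.ofReal A)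
    (h2 : ∫⁻ z in F, ENNReal.ofReal (⨍ w in E, |b w| ∂μ - b z) ∂μ ≤ ENNReal.ofReal A)
    (hA : 0 ≤ A) :
    (∃ m : ℝ, ∫⁻ z in E, ‖b z - m‖ₑ ∂μ ≤ ENNReal.ofReal (3 * A)) ∧
      ∫⁻ z in F, ‖max (-b z) 0‖ₑ ∂μ ≤ ENNReal.ofReal A := by
  have key : ∀ S : Set X, ∀ a : ℝ, μ.real S = v → IntegrableOn b S μ →
      ∫⁻ z in S, ENNReal.ofReal (a - b z) ∂μ ≤ ENNReal.ofReal A →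
      IntegrableOn (fun z => a - b z) S μ ∧ ∫ z in S, max (a - b z) 0 ∂μ ≤ A ∧
        ∫ z in S, (a - b z) ∂μ = v * a - ∫ z in S, b z ∂μ := by
    intro S a hS hbS hle
    have hSt : μ S ≠ ∞ := fun h => by simp [Measure.real, h] at hS; linarith
    have hi : IntegrableOn (fun z => a - b z) S μ := (integrableOn_const hSt).sub hbS
    refine ⟨hi, ?_, ?_⟩
    · rw [integral_eq_lintegral_of_nonneg_ae (f := fun z => max (a - b z) 0) (ae_of_all _ fun _ => le_max_right _ _)
        hi.pos_part.aestronglyMeasurable]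
      refine ENNReal.toReal_le_of_le_ofReal hA ?_
      simpa [ENNReal.ofReal_max] using hle
    · rw [integral_sub (integrableOn_const (C := a) hSt) hbS, setIntegral_const, hS, smul_eq_mul]
  obtain ⟨hi1, h1', e1⟩ := key E _ hE hbE h1
  obtain ⟨hi2, h2', e2⟩ := key F _ hF hbF h2
  set aF := ⨍ w in F, |b w| ∂μ with haF
  set aE := ⨍ w in E, |b w| ∂μ with haE
  have hvF : v * aF = ∫ w in F, |b w| ∂μ := by
    rw [haF, setAverage_eq, hF, smul_eq_mul, mul_inv_cancel_left₀ hv.ne']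
  have hvE : v * aE = ∫ w in E, |b w| ∂μ := by
    rw [haE, setAverage_eq, hE, smul_eq_mul, mul_inv_cancel_left₀ hv.ne']
  have h3 : ∫ z in E, (aF - b z) ∂μ ≤ A :=
    (integral_mono hi1 hi1.pos_part fun z => le_max_left _ _).trans h1'
  have h4 : ∫ z in F, (aE - b z) ∂μ ≤ A :=
    (integral_mono hi2 hi2.pos_part fun z => le_max_left _ _).trans h2'
  have h5 : ∫ z in E, b z ∂μ ≤ ∫ w in E, |b w| ∂μ :=
    integral_mono hbE hbE.abs fun z => le_abs_self _
  have h6 : ∫ z in F, b z ∂μ ≤ ∫ w in F, |b w| ∂μ :=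
    integral_mono hbF hbF.abs fun z => le_abs_self _
  constructor
  · refine ⟨aF, ?_⟩
    have hi3 : IntegrableOn (fun z => b z - aF) E μ :=
      Integrable.congr hi1.neg (ae_of_all _ fun z => neg_sub aF (b z))
    -- This uses `|y| = 2 * max (-y) 0 + y` for `y = b z - aF`. The first term is at most `2 * A`,
    -- and `∫_E (aF - b) = ∫_F |b| - ∫_E b ≥ ∫_F b - ∫_E |b| ≥ -A` by `h4`; hence `3 * A`.
    have h7 : ∫ z in E, ‖b z - aF‖ ∂μ =
        2 * ∫ z in E, max (aF - b z) 0 ∂μ - ∫ z in E, (aF - b z) ∂μ := by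
      rw [← integral_const_mul, ← integral_sub (hi1.pos_part.const_mul 2) hi1]
      refine integral_congr_ae (ae_of_all _ fun z => ?_)
      simp only [Real.norm_eq_abs]
      rcases le_total (b z) aF with h | h
      · rw [max_eq_left (by linarith), abs_of_nonpos (by linarith)]; ring
      · rw [max_eq_right (by linarith), abs_of_nonneg (by linarith)]; ring
    rw [← ofReal_integral_norm_eq_lintegral_enorm hi3]
    refine ENNReal.ofReal_le_ofReal ?_
    linarith
  · have hi4 : IntegrableOn (fun z => max (-b z) 0) F μ := hbF.neg.pos_part
    -- Adding `h3` and `h4` gives `∫_E (|b| - b) + ∫_F (|b| - b) ≤ 2 * A` with both terms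
    -- nonnegative, and `|b| - b` is twice the negative part.
    have h8 : 2 * ∫ z in F, ‖max (-b z) 0‖ ∂μ = ∫ w in F, |b w| ∂μ - ∫ z in F, b z ∂μ := by
      rw [← integral_const_mul, ← integral_sub hbF.abs hbF]
      refine integral_congr_ae (ae_of_all _ fun z => ?_)
      simp only [Real.norm_eq_abs]
      rw [abs_of_nonneg (le_max_right _ _)]
      rcases le_total 0 (b z) with h | h
      · rw [max_eq_right (by linarith), abs_of_nonneg h]; ring
      · rw [max_eq_left (by linarith), abs_of_nonpos h]; ring
    rw [← ofReal_integral_norm_eq_lintegral_enorm hi4]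
    refine ENNReal.ofReal_le_ofReal ?_
    linarith

/-- Oscillation bounds on two sets with large intersection give one on their union. -/
lemma lintegral_union_oscillation_le (hb : AEMeasurable b μ) {S T U : Set X}
    (hU : U ⊆ S ∪ T) (hST : μ T ≤ 2 * μ (S ∩ T)) {m m' : ℝ} {A A' : ℝ≥0∞}
    (hA : ∫⁻ z in S, ‖b z - m‖ₑ ∂μ ≤ A) (hA' : ∫⁻ z in T, ‖b z - m'‖ₑ ∂μ ≤ A') :
    ∫⁻ z in U, ‖b z - m‖ₑ ∂μ ≤ 3 * A + 3 * A' := by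
  -- Both constants approximate `b` on the overlap, so they are close to each other.
  have hm : ‖m' - m‖ₑ * μ (S ∩ T) ≤ A + A' := by
    calc ‖m' - m‖ₑ * μ (S ∩ T) = ∫⁻ _ in S ∩ T, ‖m' - m‖ₑ ∂μ := (setLIntegral_const _ _).symm
      _ ≤ ∫⁻ z in S ∩ T, (‖b z - m‖ₑ + ‖b z - m'‖ₑ) ∂μ := by
          refine lintegral_mono fun z => ?_
          have := enorm_sub_le_enorm_sub_add m' (b z) m
          rwa [enorm_sub_rev m' (b z), add_comm] at this
      _ = ∫⁻ z in S ∩ T, ‖b z - m‖ₑ ∂μ + ∫⁻ z in S ∩ T, ‖b z - m'‖ₑ ∂μ :=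
          lintegral_add_left' (hb.sub_const m).enorm.restrict _
      _ ≤ A + A' := add_le_add ((lintegral_mono_set inter_subset_left).trans hA)
          ((lintegral_mono_set inter_subset_right).trans hA')
  calc ∫⁻ z in U, ‖b z - m‖ₑ ∂μ ≤ ∫⁻ z in S, ‖b z - m‖ₑ ∂μ + ∫⁻ z in T, ‖b z - m‖ₑ ∂μ :=
        (lintegral_mono_set hU).trans (lintegral_union_le _ _ _)
    _ ≤ A + ∫⁻ z in T, (‖b z - m'‖ₑ + ‖m' - m‖ₑ) ∂μ :=
        add_le_add hA (lintegral_mono fun z => enorm_sub_le_enorm_sub_add _ _ _)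
    _ ≤ A + (A' + ‖m' - m‖ₑ * (2 * μ (S ∩ T))) := by
        rw [lintegral_add_right _ measurable_const, setLIntegral_const]
        gcongr
    _ = A + A' + 2 * (‖m' - m‖ₑ * μ (S ∩ T)) := by ring
    _ ≤ A + A' + 2 * (A + A') := by gcongr
    _ = _ := by ring

end Measure

/-! ### Testing the commutators on indicator functions. -/

section Necessity

variable {n : ℕ} {p γ : ℝ} {b : SpaceTime n → ℝ}

/-- Testing a bounded commutator with the indicator function of `F i`. -/
lemma lintegral_le_of_commutatorBounded {ι : Type*} {E F : ι → Set (SpaceTime n)}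
    {T : (SpaceTime n → ℝ) → SpaceTime n → ℝ≥0∞}
    (hT : ∀ f, T f = lagMaximal volume E F fun w => ‖f w‖ₑ) {r q : ℝ} (hr : 0 < r) (hq : 1 < q)
    (hbd : CommutatorBounded b T r q) : ∃ C : ℝ≥0, ∀ i, MeasurableSet (E i) →
      MeasurableSet (F i) → volume (F i) ≠ 0 → volume (F i) ≠ ∞ → IntegrableOn b (F i) →
      ∫⁻ z in E i, ENNReal.ofReal ((⨍ w in F i, |b w|) - b z) ≤
        C * volume (F i) ^ (1 / r) * volume (E i) ^ (1 - 1 / q) := by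
  obtain ⟨C, hC⟩ := hbd
  refine ⟨C, fun i hEm hFm hF0 hFt hbF => ?_⟩
  set f : SpaceTime n → ℝ := (F i).indicator fun _ => 1
  have hbf : (fun z => b z * f z) = (F i).indicator b := by
    ext z
    by_cases hz : z ∈ F i <;> simp [f, hz]
  obtain ⟨hTf, hTbf, hmem, hle⟩ := hC f (memLp_indicator_const _ hFm _ (.inr hFt)) (by
    rw [hbf]; exact (hbF.integrable_indicator hFm).locallyIntegrable)
  have hpt : ∀ᵐ z, z ∈ E i →
      ENNReal.ofReal ((⨍ w in F i, |b w|) - b z) ≤ ‖commutator b T f z‖ₑ := by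
    filter_upwards [hTbf] with z hz hzE
    -- Averages of an indicator never exceed `1`, and the average over `F i` itself is admissible at
    -- `z ∈ E i`.
    have h1 : T f z = 1 := by
      rw [hT]
      refine le_antisymm (iSup₂_le fun j _ => ?_) ?_
      · refine (setLAverage_mono (ae_of_all _ fun w => ?_)).trans (setLAverage_const_le (F j) 1)
        by_cases hw : w ∈ F i <;> simp [f, hw]
      · refine le_trans (le_of_eq ?_) (le_lagMaximal _ _ _ _ hzE)
        rw [setLAverage_congr_fun hFm (g := fun _ => 1)
          (fun w hw => by simp [f, hw]), setLAverage_const hF0 hFt]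
    have h2 : ENNReal.ofReal (⨍ w in F i, |b w|) ≤ T (fun w => b w * f w) z := by
      rw [hT]
      refine le_trans (le_of_eq ?_) (le_lagMaximal _ _ _ _ hzE)
      rw [ofReal_setAverage hbF.abs (ae_of_all _ fun _ => abs_nonneg _), ← setLAverage_eq]
      refine setLAverage_congr_fun hFm fun w hw => ?_
      simp [f, hw, Real.enorm_eq_ofReal_abs]
    have h3 : ⨍ w in F i, |b w| ≤ (T (fun w => b w * f w) z).toReal :=
      (ENNReal.ofReal_le_iff_le_toReal hz.ne).1 h2
    rw [commutator, h1, ENNReal.toReal_one, mul_one, Real.enorm_eq_ofReal_abs]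
    refine ENNReal.ofReal_le_ofReal ?_
    rw [abs_sub_comm]
    exact le_trans (by linarith) (le_abs_self _)
  have hq' : ENNReal.ofReal q ≠ 0 := by simp; linarith
  calc ∫⁻ z in E i, ENNReal.ofReal ((⨍ w in F i, |b w|) - b z)
      ≤ ∫⁻ z in E i, ‖commutator b T f z‖ₑ := setLIntegral_mono_ae' hEm hpt
    _ = eLpNorm (commutator b T f) 1 (volume.restrict (E i)) :=
        eLpNorm_one_eq_lintegral_enorm.symm
    _ ≤ eLpNorm (commutator b T f) (ENNReal.ofReal q) (volume.restrict (E i)) *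
          (volume.restrict (E i)) univ ^ (1 / (1 : ℝ≥0∞).toReal - 1 / (ENNReal.ofReal q).toReal) :=
        eLpNorm_le_eLpNorm_mul_rpow_measure_univ (by simpa using hq.le) hmem.1.restrict
    _ ≤ C * volume (F i) ^ (1 / r) * volume (E i) ^ (1 - 1 / q) := by
        rw [ENNReal.toReal_one, div_one, ENNReal.toReal_ofReal (by linarith),
          Measure.restrict_apply_univ]
        gcongr
        refine (eLpNorm_mono_measure _ Measure.restrict_le_self).trans (hle.trans_eq ?_)
        rw [eLpNorm_indicator_const hFm (by simpa using hr) (by simp), enorm_one, one_mul,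
          ENNReal.toReal_ofReal hr.le]

/-- Boundedness of both commutators controls the oscillation of `b` on lower parts of parabolic
rectangles and its negative part on upper parts. -/
lemma exists_oscillation_le_of_commutatorBounded (hγ : γ < 1) (hb : LocallyIntegrable b)
    {r q β : ℝ} (hr : 0 < r) (hq : 1 < q) (hrq : 1 / r - 1 / q = β)
    (h1 : CommutatorBounded b (maximalPlus p γ) r q)
    (h2 : CommutatorBounded b (maximalMinus p γ) r q) :
    ∃ C : ℝ, 0 ≤ C ∧ ∀ (x : Fin n → ℝ) (t L : ℝ), 0 < L →
      (∃ m : ℝ, ∫⁻ z in lowerPart p γ x t L, ‖b z - m‖ₑ ≤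
        ENNReal.ofReal (C * ((1 - γ) * (2 * L) ^ n * L ^ p) ^ (1 + β))) ∧
      ∫⁻ z in upperPart p γ x t L, ‖max (-b z) 0‖ₑ ≤
        ENNReal.ofReal (C * ((1 - γ) * (2 * L) ^ n * L ^ p) ^ (1 + β)) := by
  obtain ⟨C₁, hC₁⟩ := lintegral_le_of_commutatorBounded maximalPlus_eq_lagMaximal hr hq h1
  obtain ⟨C₂, hC₂⟩ := lintegral_le_of_commutatorBounded maximalMinus_eq_lagMaximal hr hq h2
  refine ⟨3 * max (C₁ : ℝ) C₂, by positivity, fun x t L hL => ?_⟩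
  have hγ' : 0 < 1 - γ := by linarith
  set v := (1 - γ) * (2 * L) ^ n * L ^ p
  have hv : 0 < v := by positivity
  have hlo : volume (lowerPart p γ x t L) = ENNReal.ofReal v := volume_lowerPart x t hL
  have hup : volume (upperPart p γ x t L) = ENNReal.ofReal v := volume_upperPart x t hL
  have hlm : MeasurableSet (lowerPart p γ x t L) := measurableSet_ball.prod measurableSet_Ioo
  have hum : MeasurableSet (upperPart p γ x t L) := measurableSet_ball.prod measurableSet_Ioo
  have hv0 : ENNReal.ofReal v ≠ 0 := by simpa using hv
  have hbl : IntegrableOn b (lowerPart p γ x t L) := integrableOn_cube_prod_Ioo hb _ _ _ _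
  have hbu : IntegrableOn b (upperPart p γ x t L) := integrableOn_cube_prod_Ioo hb _ _ _ _
  set A : ℝ := max (C₁ : ℝ) C₂ * v ^ (1 + β)
  have hCA : ∀ C : ℝ≥0, (C : ℝ) ≤ max (C₁ : ℝ) C₂ →
      (C : ℝ≥0∞) * ENNReal.ofReal v ^ (1 / r) * ENNReal.ofReal v ^ (1 - 1 / q) ≤
        ENNReal.ofReal A := fun C hC => by
    rw [mul_assoc, ← ENNReal.rpow_add _ _ hv0 ENNReal.ofReal_ne_top,
      -- The norm of the indicator gives the exponent `1 / r`, Hölder on the other part gives `1 - 1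
      -- / q`.
      show 1 / r + (1 - 1 / q) = 1 + β by rw [← hrq]; ring, ENNReal.ofReal_rpow_of_pos hv,
      ← ENNReal.ofReal_coe_nnreal, ← ENNReal.ofReal_mul C.coe_nonneg]
    exact ENNReal.ofReal_le_ofReal (mul_le_mul_of_nonneg_right hC (by positivity))
  have k1 := hC₁ (x, t, ⟨L, hL⟩) hlm hum (by simp only [hup]; exact hv0) (by simp [hup]) hbu
  have k2 := hC₂ (x, t, ⟨L, hL⟩) hum hlm (by simp only [hlo]; exact hv0) (by simp [hlo]) hbl
  simp only [hlo, hup] at k1 k2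
  have hA : 0 ≤ A := by positivity
  obtain ⟨⟨m, hm⟩, hneg⟩ := oscillation_and_negPart_le hv
    (by rw [Measure.real, hlo, ENNReal.toReal_ofReal hv.le])
    (by rw [Measure.real, hup, ENNReal.toReal_ofReal hv.le]) hbl hbu
    (k1.trans (hCA C₁ (le_max_left _ _))) (k2.trans (hCA C₂ (le_max_right _ _))) hA
  have e : 3 * max (C₁ : ℝ) C₂ * v ^ (1 + β) = 3 * A := by ring
  rw [e]
  exact ⟨⟨m, hm⟩, hneg.trans (ENNReal.ofReal_le_ofReal (by linarith))⟩

/-- Time intervals of length `h` are shifted by `h / 2`: each new one overlaps the union so far in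
half its length, and each step costs at most a factor `4`. -/
lemma exists_oscillation_le_of_chain (hb : AEMeasurable b) {x : Fin n → ℝ} {L h : ℝ} (hL : 0 < L)
    (hh : 0 < h) {A : ℝ≥0∞}
    (hosc : ∀ s, ∃ m : ℝ, ∫⁻ z in cube x L ×ˢ Ioo s (s + h), ‖b z - m‖ₑ ≤ A) (s : ℝ) (N : ℕ) :
    ∃ m : ℝ, ∫⁻ z in cube x L ×ˢ Ioo s (s + h + N * (h / 2)), ‖b z - m‖ₑ ≤ 4 ^ (N + 1) * A := by
  induction N with
  | zero =>
    obtain ⟨m, hm⟩ := hosc s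
    refine ⟨m, ?_⟩
    simp only [CharP.cast_eq_zero, zero_mul, add_zero, zero_add, pow_one]
    exact hm.trans (le_mul_of_one_le_left' (by norm_num))
  | succ N ih =>
    obtain ⟨m, hm⟩ := ih
    obtain ⟨m', hm'⟩ := hosc (s + h + N * (h / 2) - h / 2)
    have hN : 0 ≤ N * (h / 2) := by positivity
    refine ⟨m, (lintegral_union_oscillation_le hb ?_ ?_ hm hm').trans ?_⟩
    · rw [← prod_union]
      refine prod_mono Subset.rfl fun y hy => ?_
      push_cast at hy
      rcases lt_or_ge y (s + h + N * (h / 2)) with hlt | hge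
      · exact .inl ⟨hy.1, hlt⟩
      · exact .inr ⟨by linarith, by linarith [hy.2]⟩
    · rw [← prod_inter, Ioo_inter_Ioo, max_eq_right (by linarith), min_eq_left (by linarith),
        volume_cube_prod_Ioo x hL, volume_cube_prod_Ioo x hL]
      rw [show (2 : ℝ≥0∞) = ENNReal.ofReal 2 by simp, ← ENNReal.ofReal_mul two_pos.le]
      refine ENNReal.ofReal_le_ofReal (le_of_eq ?_)
      ring
    · calc 3 * (4 ^ (N + 1) * A) + 3 * A ≤ 3 * (4 ^ (N + 1) * A) + 4 ^ (N + 1) * A := by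
            gcongr
            calc (3 : ℝ≥0∞) ≤ 4 ^ 1 := by norm_num
              _ ≤ 4 ^ (N + 1) := pow_le_pow_right₀ (by norm_num) (by omega)
        _ = _ := by ring

/-- The rectangle is covered by a chain of time translates of its own lower part, whose number
depends only on `γ`; this is how the lag disappears. -/
lemma memPC_of_oscillation_lowerPart_le (hγ : γ < 1) (hb : LocallyIntegrable b) {β C : ℝ}
    (hβ : 0 ≤ β) (hC : 0 ≤ C)
    (hosc : ∀ (x : Fin n → ℝ) (t L : ℝ), 0 < L →
      ∃ m : ℝ, ∫⁻ z in lowerPart p γ x t L, ‖b z - m‖ₑ ≤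
        ENNReal.ofReal (C * ((1 - γ) * (2 * L) ^ n * L ^ p) ^ (1 + β))) : MemPC p β b := by
  have hγ' : 0 < 1 - γ := by linarith
  -- `N` half steps of length `(1 - γ) * L ^ p / 2` must exhaust the height `2 * L ^ p`. The ratio
  -- `(1 - γ) / 2` in `c` is that of the volumes of lower part and rectangle.
  obtain ⟨N, hN⟩ := exists_nat_ge (4 / (1 - γ))
  rw [div_le_iff₀ hγ'] at hN
  set c : ℝ≥0∞ := 4 ^ (N + 1) * ENNReal.ofReal (C * ((1 - γ) / 2) ^ (1 + β))
  refine ⟨hb, lt_of_le_of_lt (b := 2 * c) ?_ (by finiteness)⟩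
  refine iSup₂_le fun x t => iSup₂_le fun L hL => ?_
  have hLp : 0 < L ^ p := by positivity
  set V := volume (rect p x t L) with hV
  have hVe : V = ENNReal.ofReal ((2 * L) ^ n * (2 * L ^ p)) := by
    rw [hV, rect, volume_cube_prod_Ioo x hL]
    congr 1; ring
  have hV0 : V ≠ 0 := by
    rw [hVe, ne_eq, ENNReal.ofReal_eq_zero, not_le]; positivity
  have hVt : V ≠ ∞ := by rw [hVe]; exact ENNReal.ofReal_ne_top
  obtain ⟨m, hm⟩ := exists_oscillation_le_of_chain hb.aestronglyMeasurable.aemeasurable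
    (x := x) hL (h := (1 - γ) * L ^ p) (by positivity)
    (A := ENNReal.ofReal (C * ((1 - γ) * (2 * L) ^ n * L ^ p) ^ (1 + β))) (fun s => by
      have := hosc x (s + L ^ p) L hL
      rwa [lowerPart, show s + L ^ p - L ^ p = s by ring,
        show s + L ^ p - γ * L ^ p = s + (1 - γ) * L ^ p by ring] at this) (t - L ^ p) N
  have hsub : rect p x t L ⊆ cube x L ×ˢ
      Ioo (t - L ^ p) (t - L ^ p + (1 - γ) * L ^ p + N * ((1 - γ) * L ^ p / 2)) := by
    refine prod_mono Subset.rfl (Ioo_subset_Ioo le_rfl ?_)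
    nlinarith [mul_le_mul_of_nonneg_right hN hLp.le, mul_pos hγ' hLp]
  have hav : ⨍⁻ z in rect p x t L, ‖b z - m‖ₑ ∂volume ≤ c * V ^ β := by
    rw [setLAverage_eq, ENNReal.div_le_iff hV0 hVt]
    refine (lintegral_mono_set hsub).trans (hm.trans (le_of_eq ?_))
    have e : c * V ^ β * V = 4 ^ (N + 1) *
        (ENNReal.ofReal (C * ((1 - γ) / 2) ^ (1 + β)) * V ^ (β + 1)) := by
      rw [ENNReal.rpow_add _ _ hV0 hVt, ENNReal.rpow_one]; ring
    rw [e, hVe]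
    congr 1
    rw [ENNReal.ofReal_rpow_of_nonneg (by positivity) (by positivity),
      ← ENNReal.ofReal_mul (by positivity), mul_assoc C, add_comm β 1,
      ← Real.mul_rpow (by positivity) (by positivity)]
    congr 3
    ring
  have hbR : IntegrableOn b (rect p x t L) := integrableOn_cube_prod_Ioo hb _ _ _ _
  have hm2 : ⨍⁻ z in rect p x t L, ‖b z - ⨍ w in rect p x t L, b w‖ₑ ∂volume ≤
      2 * (c * V ^ β) := by
    calc _ ≤ ⨍⁻ z in rect p x t L, (‖b z - m‖ₑ + ‖(⨍ w in rect p x t L, b w) - m‖ₑ) ∂volume := by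
          refine setLAverage_mono (ae_of_all _ fun z => ?_)
          rw [enorm_sub_rev (⨍ w in rect p x t L, b w) m]
          exact enorm_sub_le_enorm_sub_add _ _ _
      _ = ⨍⁻ z in rect p x t L, ‖b z - m‖ₑ ∂volume + ‖(⨍ w in rect p x t L, b w) - m‖ₑ := by
          rw [setLAverage_add_left
            (hb.aestronglyMeasurable.aemeasurable.sub_const m).enorm.restrict,
            setLAverage_const hV0 hVt]
      _ ≤ c * V ^ β + c * V ^ β :=
          add_le_add hav ((enorm_setAverage_sub_le hbR hV0 hVt m).trans hav)
      _ = _ := (two_mul _).symm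
  calc _ ≤ V ^ (-β) * (2 * (c * V ^ β)) := mul_le_mul_right hm2 _
    _ = 2 * c * (V ^ (-β) * V ^ β) := by ring
    _ = 2 * c := by rw [← ENNReal.rpow_add _ _ hV0 hVt, neg_add_cancel, ENNReal.rpow_zero, mul_one]

/-- Every rectangle lies in the upper part of a rectangle of comparable size, so averages of the
negative part over small balls at `z` are controlled. The radius `ρ` is kept free: any fixed value
gives boundedness if `β = 0`, and `ρ → 0` gives vanishing if `β > 0`. -/
lemma ae_negPart_le_of_lintegral_upperPart_le [hp : Fact (1 < p)] (hγ : γ ∈ Ioo (0 : ℝ) 1)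
    (hb : LocallyIntegrable b) {β C : ℝ} (hβ : 0 ≤ β) (hC : 0 ≤ C)
    (hneg : ∀ (x : Fin n → ℝ) (t L : ℝ), 0 < L → ∫⁻ z in upperPart p γ x t L, ‖max (-b z) 0‖ₑ ≤
        ENNReal.ofReal (C * ((1 - γ) * (2 * L) ^ n * L ^ p) ^ (1 + β))) :
    ∃ D : ℝ≥0∞, D ≠ ∞ ∧ ∀ᵐ z, ∀ ρ : ℝ, 0 < ρ →
      ‖max (-b z) 0‖ₑ ≤ D * ENNReal.ofReal (2 ^ (n + 1) * ρ ^ ((n : ℝ) + p)) ^ β := by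
  have hγ' : 0 < 1 - γ := by linarith [hγ.2]
  have hp0 : 0 < p := one_pos.trans hp.out
  have hV := hasBallVolume_parabolicSpace (n := n) (p := p)
  -- With `k ^ p = 2 / (1 - γ)` the upper part of a rectangle of size `k * ρ` has height `2 * ρ ^
  -- p`, that of the given rectangle; the time shift by `(1 + γ) / 2 * (k * ρ) ^ p` below aligns the
  -- two.
  set k : ℝ := (2 / (1 - γ)) ^ p⁻¹
  have hk1 : 1 ≤ k := Real.one_le_rpow (by rw [le_div_iff₀ hγ']; linarith [hγ.1]) (by positivity)
  have hkp : k ^ p = 2 / (1 - γ) := Real.rpow_inv_rpow (by positivity) hp0.ne'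
  set D : ℝ := C * (k ^ n) ^ (1 + β)
  have hav : ∀ (z : ParabolicSpace n p) (ρ : ℝ), 0 < ρ →
      ⨍⁻ w in ball z ρ, ‖max (-b w) 0‖ₑ ∂volume ≤ ENNReal.ofReal D * volume (ball z ρ) ^ β := by
    intro z ρ hρ
    have h0 := hV.measure_ball_ne_zero z hρ
    have ht := hV.measure_ball_ne_top z ρ
    have hρp : 0 < ρ ^ p := by positivity
    have hkρ : (k * ρ) ^ p = 2 / (1 - γ) * ρ ^ p := by
      rw [Real.mul_rpow (by positivity) hρ.le, hkp]
    have hsub : rect p z.1 z.2 ρ ⊆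
        upperPart p γ z.1 (z.2 - (1 + γ) / 2 * (k * ρ) ^ p) (k * ρ) := by
      refine prod_mono (ball_subset_ball (le_mul_of_one_le_left hρ.le hk1)) (Ioo_subset_Ioo ?_ ?_)
      · rw [hkρ]; field_simp; linarith
      · rw [hkρ]; field_simp; linarith
    have hvol : volume (ball z ρ) = ENNReal.ofReal ((2 * ρ) ^ n * (2 * ρ ^ p)) := by
      rw [parabolicSpace_ball z hρ]
      refine (volume_cube_prod_Ioo z.1 hρ _ _).trans ?_
      congr 1; ring
    rw [setLAverage_eq, ENNReal.div_le_iff h0 ht]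
    calc ∫⁻ w in ball z ρ, ‖max (-b w) 0‖ₑ
        ≤ ENNReal.ofReal (C * ((1 - γ) * (2 * (k * ρ)) ^ n * (k * ρ) ^ p) ^ (1 + β)) := by
          rw [parabolicSpace_ball z hρ]
          exact (lintegral_mono_set hsub).trans (hneg _ _ _ (by positivity))
      _ = ENNReal.ofReal D * (volume (ball z ρ) ^ β * volume (ball z ρ) ^ (1 : ℝ)) := by
          rw [← ENNReal.rpow_add _ _ h0 ht, hvol,
            ENNReal.ofReal_rpow_of_nonneg (by positivity) (by positivity),
            ← ENNReal.ofReal_mul (by positivity)]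
          simp only [D]
          rw [mul_assoc C, ← add_comm 1 β, ← Real.mul_rpow (by positivity) (by positivity), hkρ]
          congr 3
          field_simp
          rw [← mul_pow]
          congr 1
          ring
      _ = _ := by rw [ENNReal.rpow_one]; ring
  refine ⟨ENNReal.ofReal D, ENNReal.ofReal_ne_top, ?_⟩
  have hneg' : ∀ (z : ParabolicSpace n p) (ρ : ℝ),
      IntegrableOn (fun w : ParabolicSpace n p => max (-b w) 0) (ball z ρ) volume := fun z ρ =>
    (integrableOn_parabolicSpace_ball hb z ρ).neg.pos_part
  have hae : ∀ᵐ z : ParabolicSpace n p, ∀ ρ : ℝ, 0 < ρ →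
      ‖max (-b z) 0‖ₑ ≤ ENNReal.ofReal D *
        ENNReal.ofReal (2 ^ (n + 1) * ρ ^ ((n : ℝ) + p)) ^ β := by
    filter_upwards [hV.ae_enorm_sub_le_of_setLAverage_le hneg'] with z hz ρ hρ
    have hlim : Tendsto (fun j : ℕ => (1 / 2 : ℝ) ^ j * ρ) atTop (𝓝 0) := by
      have := (tendsto_pow_atTop_nhds_zero_of_lt_one (r := (1 / 2 : ℝ)) (by norm_num)
        (by norm_num)).mul_const ρ
      rwa [zero_mul] at this
    have := hz 0 (ENNReal.ofReal D * ENNReal.ofReal (2 ^ (n + 1) * ρ ^ ((n : ℝ) + p)) ^ β)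
      (fun j => (1 / 2) ^ j * ρ) (fun j => by positivity) hlim fun j => by
        simp only [sub_zero]
        refine (hav z _ (by positivity)).trans ?_
        rw [← hV.measure_ball z ρ hρ]
        gcongr
        exact mul_le_of_le_one_left hρ.le (pow_le_one₀ (by norm_num) (by norm_num))
    rwa [sub_zero] at this
  exact hae

lemma memPC_and_negPart_of_commutatorBounded [hp : Fact (1 < p)] (hγ : γ ∈ Ioo (0 : ℝ) 1)
    (hb : LocallyIntegrable b) {r q β : ℝ} (hr : 0 < r) (hq : 1 < q) (hβ : 0 ≤ β)
    (hrq : 1 / r - 1 / q = β) (h1 : CommutatorBounded b (maximalPlus p γ) r q)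
    (h2 : CommutatorBounded b (maximalMinus p γ) r q) :
    MemPC p β b ∧ ∃ D : ℝ≥0∞, D ≠ ∞ ∧ ∀ᵐ z, ∀ ρ : ℝ, 0 < ρ →
      ‖max (-b z) 0‖ₑ ≤ D * ENNReal.ofReal (2 ^ (n + 1) * ρ ^ ((n : ℝ) + p)) ^ β := by
  obtain ⟨C, hC, h⟩ := exists_oscillation_le_of_commutatorBounded hγ.2 hb hr hq hrq h1 h2
  exact ⟨memPC_of_oscillation_lowerPart_le hγ.2 hb hβ hC fun x t L hL => (h x t L hL).1,
    ae_negPart_le_of_lintegral_upperPart_le hγ hb hβ hC fun x t L hL => (h x t L hL).2⟩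

lemma memPBMO_of_commutatorBounded [hp : Fact (1 < p)] (hγ : γ ∈ Ioo (0 : ℝ) 1)
    (hb : LocallyIntegrable b) {q : ℝ} (hq : 1 < q)
    (h1 : CommutatorBounded b (maximalPlus p γ) q q)
    (h2 : CommutatorBounded b (maximalMinus p γ) q q) :
    MemPBMO p b ∧ MemLp (fun z => max (-b z) 0) ∞ := by
  obtain ⟨hPC, D, hD, h⟩ := memPC_and_negPart_of_commutatorBounded hγ hb (by linarith) hq le_rfl
    (sub_self _) h1 h2
  refine ⟨hPC, (hb.aestronglyMeasurable.aemeasurable.neg.max aemeasurable_const).aestronglyMeasurable,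
    ?_⟩
  rw [eLpNorm_exponent_top]
  refine lt_of_le_of_lt (essSup_le_of_ae_le D ?_) hD.lt_top
  filter_upwards [h] with z hz
  simpa using hz 1 one_pos

lemma memPC_of_commutatorBounded [hp : Fact (1 < p)] (hγ : γ ∈ Ioo (0 : ℝ) 1)
    (hb : LocallyIntegrable b) {r q β : ℝ} (hr : 0 < r) (hq : 1 < q) (hβ : 0 < β)
    (hrq : 1 / r - 1 / q = β) (h1 : CommutatorBounded b (maximalPlus p γ) r q)
    (h2 : CommutatorBounded b (maximalMinus p γ) r q) :
    MemPC p β b ∧ ∀ᵐ z, 0 ≤ b z := by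
  obtain ⟨hPC, D, hD, h⟩ := memPC_and_negPart_of_commutatorBounded hγ hb hr hq hβ.le hrq h1 h2
  refine ⟨hPC, ?_⟩
  have hQ : 0 < (n : ℝ) + p := hasBallVolume_parabolicSpace.Q_pos
  have hlim : Tendsto (fun ρ : ℝ => D * ENNReal.ofReal (2 ^ (n + 1) * ρ ^ ((n : ℝ) + p)) ^ β)
      (𝓝[>] 0) (𝓝 0) := by
    have h3 : Tendsto (fun ρ : ℝ => 2 ^ (n + 1) * ρ ^ ((n : ℝ) + p)) (𝓝[>] 0) (𝓝 0) := by
      have := ((Real.continuous_rpow_const hQ.le).tendsto 0).const_mul (2 ^ (n + 1))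
      rw [Real.zero_rpow hQ.ne', mul_zero] at this
      exact this.mono_left nhdsWithin_le_nhds
    have h4 := ((ENNReal.continuous_rpow_const (y := β)).tendsto _).comp (ENNReal.tendsto_ofReal h3)
    rw [ENNReal.ofReal_zero, ENNReal.zero_rpow_of_pos hβ] at h4
    have h5 := ENNReal.Tendsto.const_mul h4 (a := D) (.inr hD)
    rwa [mul_zero] at h5
  filter_upwards [h] with z hz
  have h6 : ‖max (-b z) 0‖ₑ ≤ 0 := by
    refine ge_of_tendsto hlim ?_
    filter_upwards [self_mem_nhdsWithin] with ρ hρ using hz ρ hρ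
  rw [le_zero_iff, enorm_eq_zero, max_eq_right_iff] at h6
  linarith

end Necessity

end Parabolic

end

theorem mainTheorem7 {n : ℕ} (hn : 1 ≤ n) (p : ℝ) (hp : 1 < p)
    (γ : ℝ) (hγ : γ ∈ Set.Ioo (0 : ℝ) 1)
    (β : ℝ) (hβ : β ∈ Set.Ioo (0 : ℝ) (1 / ((n : ℝ) + p)))
    (b : Parabolic.SpaceTime n → ℝ) (hb : LocallyIntegrable b) :
    -- (i): the characterization of `PBMO` functions with bounded negative part
    (((Parabolic.MemPBMO p b ∧ MemLp (fun z => max (-b z) 0) ∞) ↔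
        ∀ q : ℝ, 1 < q →
          Parabolic.CommutatorBounded b (Parabolic.maximalPlus p γ) q q ∧
          Parabolic.CommutatorBounded b (Parabolic.maximalMinus p γ) q q) ∧
      ((Parabolic.MemPBMO p b ∧ MemLp (fun z => max (-b z) 0) ∞) ↔
        ∃ q : ℝ, 1 < q ∧
          Parabolic.CommutatorBounded b (Parabolic.maximalPlus p γ) q q ∧
          Parabolic.CommutatorBounded b (Parabolic.maximalMinus p γ) q q)) ∧
    -- (ii): the characterization of nonnegative functions in `PC^β`
    (((Parabolic.MemPC p β b ∧ ∀ᵐ z, 0 ≤ b z) ↔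
        ∀ r q : ℝ, 1 < r → r < q → 1 / r - 1 / q = β →
          Parabolic.CommutatorBounded b (Parabolic.maximalPlus p γ) r q ∧
          Parabolic.CommutatorBounded b (Parabolic.maximalMinus p γ) r q) ∧
      ((Parabolic.MemPC p β b ∧ ∀ᵐ z, 0 ≤ b z) ↔
        ∃ r q : ℝ, 1 < r ∧ r < q ∧ 1 / r - 1 / q = β ∧
          Parabolic.CommutatorBounded b (Parabolic.maximalPlus p γ) r q ∧
          Parabolic.CommutatorBounded b (Parabolic.maximalMinus p γ) r q)) ∧
    -- in both cases the natural domain of the commutators contains all of `L^r`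
    ((Parabolic.MemPBMO p b ∨ Parabolic.MemPC p β b) →
      ∀ r : ℝ, 1 < r → ∀ f : Parabolic.SpaceTime n → ℝ, MemLp f (ENNReal.ofReal r) →
        LocallyIntegrable (fun z => b z * f z)) := by
  have : Fact (1 < p) := ⟨hp⟩
  have hβ1 : β < 1 := by
    have hnp : 1 < (n : ℝ) + p := by linarith [(Nat.cast_nonneg n : (0 : ℝ) ≤ n)]
    exact hβ.2.trans ((div_lt_one (by linarith)).2 hnp)
  have hβ0 := hβ.1
  -- The pair `1 / r = (1 + β) / 2`, `1 / q = (1 - β) / 2` is admissible because `0 < β < 1`. It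
  -- shows that the universal statement in (ii) is not vacuous and witnesses the existential one.
  have hr : 1 < 2 / (1 + β) := by rw [lt_div_iff₀ (by linarith)]; linarith
  have hrq : 2 / (1 + β) < 2 / (1 - β) :=
    div_lt_div_of_pos_left (by norm_num) (by linarith) (by linarith)
  have he : 1 / (2 / (1 + β)) - 1 / (2 / (1 - β)) = β := by
    rw [one_div_div, one_div_div]; ring
  have suff₀ : (Parabolic.MemPBMO p b ∧ MemLp (fun z => max (-b z) 0) ∞) → ∀ q : ℝ, 1 < q →
      Parabolic.CommutatorBounded b (Parabolic.maximalPlus p γ) q q ∧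
      Parabolic.CommutatorBounded b (Parabolic.maximalMinus p γ) q q :=
    fun h q hq => Parabolic.commutatorBounded_of_memPBMO hγ h.1 h.2 hq
  have suff : (Parabolic.MemPC p β b ∧ ∀ᵐ z, 0 ≤ b z) →
      ∀ r q : ℝ, 1 < r → r < q → 1 / r - 1 / q = β →
        Parabolic.CommutatorBounded b (Parabolic.maximalPlus p γ) r q ∧
        Parabolic.CommutatorBounded b (Parabolic.maximalMinus p γ) r q :=
    fun h r q hr hrq he => Parabolic.commutatorBounded_of_memPC hγ hβ0 h.1 h.2 hr (hr.trans hrq) he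
  have nec₀ : ∀ q : ℝ, 1 < q → Parabolic.CommutatorBounded b (Parabolic.maximalPlus p γ) q q ∧
      Parabolic.CommutatorBounded b (Parabolic.maximalMinus p γ) q q →
      Parabolic.MemPBMO p b ∧ MemLp (fun z => max (-b z) 0) ∞ :=
    fun q hq h => Parabolic.memPBMO_of_commutatorBounded hγ hb hq h.1 h.2
  have nec : ∀ r q : ℝ, 1 < r → r < q → 1 / r - 1 / q = β →
      Parabolic.CommutatorBounded b (Parabolic.maximalPlus p γ) r q ∧
      Parabolic.CommutatorBounded b (Parabolic.maximalMinus p γ) r q →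
      Parabolic.MemPC p β b ∧ ∀ᵐ z, 0 ≤ b z :=
    fun r q hr hrq he h => Parabolic.memPC_of_commutatorBounded hγ hb (by linarith)
      (hr.trans hrq) hβ0 he h.1 h.2
  refine ⟨⟨⟨suff₀, fun h => nec₀ 2 one_lt_two (h 2 one_lt_two)⟩,
    ⟨fun h => ⟨2, one_lt_two, suff₀ h 2 one_lt_two⟩, fun ⟨q, hq, h⟩ => nec₀ q hq h⟩⟩,
    ⟨⟨suff, fun h => nec _ _ hr hrq he (h _ _ hr hrq he)⟩,
    ⟨fun h => ⟨_, _, hr, hrq, he, suff h _ _ hr hrq he⟩,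
      fun ⟨r, q, hr, hrq, he, h⟩ => nec r q hr hrq he h⟩⟩, ?_⟩
  rintro (h | h) r hr f hf
  · exact h.locallyIntegrable_mul hr hf
  · exact h.locallyIntegrable_mul hβ0 hr hf
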